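/- All graphs are finite and simple. A graph $G$ is $2$-connected if it has at least three vertices, is connected, and remains connected after the deletion of any one vertex. A cycle $C$ of $G$ is dominating if every edge of $G$ is incident with a vertex of $C$. Write $H\prec G$ if $H$ is isomorphic to an induced subgraph of $G$. For a set $\mathcal H$ of connected graphs, $G$ is $\mathcal H$-free if $H\not\prec G$ for every $H\in\mathcal H$; and $\mathcal H\le\mathcal H'$ means that for every $H'\in\mathcal H'$ there is $H\in\mathcal H$ with $H\prec H'$. $P_n$ is the path on $n$ vertices and $K_{1,3}$ is the claw. $N_{l,m,n}$ is obtained from a triangle by attaching to its three vertices, respectively, disjoint paths with $l$, $m$ and $n$ additional vertices (no path is attached if the number is $0$); $B_{m,n}=N_{m,n,0}$ and $Z_n=N_{n,0,0}$. $K_{1,3}^{*}$ is obtained from $K_{1,3}$ by subdividing each edge once. $W$ consists of three triangles that share exactly one common vertex, $W^{*}$ is obtained from $W$ by deleting one vertex of degree $2$ (two triangles sharing a vertex, with a pendant edge at that vertex), and $K_4^-$ is $K_4$ minus an edge. Put $$\mathcal H_1=\{K_{1,3},Z_4\},\quad \mathcal H_2=\{K_{1,3},B_{1,2}\},\quad \mathcal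 H_3=\{K_{1,3},N_{1,1,1}\},\quad \mathcal H_4=\{P_4,W\},$$ $$\mathcal H_5=\{K_{1,3}^{*},Z_1\},\quad \mathcal H_6=\{P_5,W^{*}\},\quad \mathcal H_7=\{P_5,K_4^-\}.$$ Theorem. Let $\mathcal H=\{H_1,H_2\}$ be a pair of connected graphs. Suppose that there is a positive integer $n_0$ such that every $2$-connected $\mathcal H$-free graph of order at least $n_0$ has a dominating cycle. Then $\mathcal H\le\mathcal H_i$ for some $i\in\{1,\dots,7\}$. -/

import Mathlib

open scoped SimpleGraph

namespace ForbiddenPair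

/-- A finite simple graph, bundled with its vertex type. -/
structure FinGraph where
  V : Type
  [fintypeV : Fintype V]
  graph : SimpleGraph V

attribute [instance] FinGraph.fintypeV

/-- The number of vertices of `G`. -/
def FinGraph.order (G : FinGraph) : ℕ := Fintype.card G.V

/-- `G ≺ H`: the graph `G` is (isomorphic to) an induced subgraph of `H`. -/
def IndSub (G H : FinGraph) : Prop := G.graph ⊴ H.graph

/-- `G` is `ℋ`-free: no member of `ℋ` is an induced subgraph of `G`. -/
def IsFree (ℋ : Set FinGraph) (G : FinGraph) : Prop := ∀ H ∈ ℋ, ¬ IndSub H G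

/-- `ℋ₁ ≤ ℋ₂`: every member of `ℋ₂` has a member of `ℋ₁` as an induced subgraph. -/
def FamilyLE (ℋ₁ ℋ₂ : Set FinGraph) : Prop := ∀ H₂ ∈ ℋ₂, ∃ H₁ ∈ ℋ₁, IndSub H₁ H₂

/-- `G` is `2`-connected: it has more than two vertices and stays connected when fewer than
two vertices are deleted. -/
def TwoConnected (G : FinGraph) : Prop :=
  2 < G.order ∧ G.graph.Connected ∧ ∀ v : G.V, (G.graph.induce {v}ᶜ).Connected

/-- `G` has a dominating cycle: a cycle such that every edge of `G` is incident with one of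
its vertices. -/
def HasDominatingCycle (G : FinGraph) : Prop :=
  ∃ (v : G.V) (C : G.graph.Walk v v), C.IsCycle ∧
    ∀ x y : G.V, G.graph.Adj x y → x ∈ C.support ∨ y ∈ C.support

/-- The graph `G` as a bundled finite graph. -/
abbrev FinGraph.of {V : Type} [Fintype V] (G : SimpleGraph V) : FinGraph := ⟨V, G⟩

/-- The claw `K_{1,3}`. -/
abbrev claw : SimpleGraph (Fin 1 ⊕ Fin 3) := completeBipartiteGraph (Fin 1) (Fin 3)

/-- `N_{l,m,n}`: a triangle with vertices `(0, 0)`, `(1, 0)`, `(2, 0)`, to which disjoint paths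
with `l`, `m` and `n` further vertices are attached, one at each vertex of the triangle. The
vertex `(i, a)` is the one at distance `a` from the triangle on the `i`-th of these paths. -/
def net (l m n : ℕ) : SimpleGraph (Σ i : Fin 3, Fin (![l, m, n] i + 1)) :=
  SimpleGraph.fromRel fun p q =>
    (p.1 ≠ q.1 ∧ (p.2 : ℕ) = 0 ∧ (q.2 : ℕ) = 0) ∨ (p.1 = q.1 ∧ (q.2 : ℕ) = (p.2 : ℕ) + 1)

/-- `B_{m,n}`: a triangle with paths of `m` and `n` further vertices attached at two different
vertices of it. -/
abbrev bull (m n : ℕ) := net m n 0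

/-- `Z_n`: a triangle with a path of `n` further vertices attached at one vertex of it. -/
abbrev zGraph (n : ℕ) := net n 0 0

/-- `K_{1,3}^*`: the claw (with centre `0`) with every edge subdivided once. -/
def clawStar : SimpleGraph (Fin 7) :=
  SimpleGraph.fromEdgeSet {s(0, 1), s(0, 2), s(0, 3), s(1, 4), s(2, 5), s(3, 6)}

/-- `W`: three triangles sharing exactly the vertex `0`. -/
def wGraph : SimpleGraph (Fin 7) :=
  SimpleGraph.fromEdgeSet
    {s(0, 1), s(0, 2), s(1, 2), s(0, 3), s(0, 4), s(3, 4), s(0, 5), s(0, 6), s(5, 6)}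

/-- `W^*`: two triangles sharing exactly the vertex `0`, and a pendant edge at `0`. -/
def wStar : SimpleGraph (Fin 6) :=
  SimpleGraph.fromEdgeSet {s(0, 1), s(0, 2), s(1, 2), s(0, 3), s(0, 4), s(3, 4), s(0, 5)}

/-- `K_4^-`: the complete graph on four vertices with one edge removed. -/
def k4Minus : SimpleGraph (Fin 4) :=
  (⊤ : SimpleGraph (Fin 4)).deleteEdges {s(2, 3)}

/-- The seven pairs `ℋ_1, …, ℋ_7` (indexed from `0`); `SimpleGraph.pathGraph n` is the path
`P_n` on `n` vertices. -/
def pair : Fin 7 → Set FinGraph :=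
  ![{.of claw, .of (zGraph 4)},
    {.of claw, .of (bull 1 2)},
    {.of claw, .of (net 1 1 1)},
    {.of (SimpleGraph.pathGraph 4), .of wGraph},
    {.of clawStar, .of (zGraph 1)},
    {.of (SimpleGraph.pathGraph 5), .of wStar},
    {.of (SimpleGraph.pathGraph 5), .of k4Minus}]

end ForbiddenPair

/-! Call a 2-connected graph without a dominating cycle an obstruction. The hypothesis says exactly
that every large obstruction contains `H₁` or `H₂` as an induced subgraph, so the proof tests the
pair against nine infinite families of obstructions.

All nine have three nontrivial pieces, each of which a dominating cycle would have to meet. If the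
pieces are attached to two hubs, the cycle needs two edges out of each piece, six in all, while the
hubs supply at most four (`not_hasDominatingCycle_of_separating_pair`). If the pieces are joined by
two triangles, degree and cut inequalities force the cycle to use exactly one triangle edge at each
vertex of a triangle, which violates the handshake lemma on three vertices
(`not_hasDominatingCycle_of_two_triangles`).

Two vertices joined by three long paths force one graph, say `A`, into an infinite three-legged
spider; so `A` is a path or contains the claw (`spider_cases`).

If `A` is the path on `j` vertices, every family without that path must contain `B`. For `j ≥ 4`
three hub families put `B` inside two nonadjacent hubs joined to three cliques, with no induced
4-cycle and no `K₄`, hence inside `W` or `K₄⁻`; as `j` grows, further families shrink `B` to `W*`,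
to the claw and finally to `P₃` (`exists_familyLE_of_path`).

If `A` contains the claw, then `B` lies in every claw-free family. Two triangles joined by long
paths show that `B` is a path, which is the previous case, or some `N_{a,b,c}` (`infiniteNet_cases`,
`exists_sorted_net`). If `A` is inside the claw, the clique prisms leave only `Z₄`, `B_{1,2}` and
`N_{1,1,1}` as maximal choices for `B`. Otherwise `A` contains `P₄`, which forces `B` into `Z₁`; the
triangle of `B` then forces `A` into a bipartite family, and so into `K_{1,3}*`
(`exists_familyLE_of_spider`).

The nine families have boundedly many types of vertices or are made of long paths. Exclusions in the
former reduce to a finite search over types, independent of the size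
(`not_isIndContained_of_search`). -/

namespace ForbiddenPair

/-! ### Counting related ordered pairs -/

section Counting

variable {V : Type}

open Classical in
/-- The number of ordered pairs `(x, y)` with `x ∈ S`, `y ∈ T` that are related by `r`. -/
noncomputable def pairCount (r : V → V → Prop) (S T : Finset V) : ℕ :=
  ∑ x ∈ S, ∑ y ∈ T, if r x y then 1 else 0

variable {r : V → V → Prop}

lemma pairCount_comm (hr : ∀ x y, r x y → r y x) (S T : Finset V) :
    pairCount r S T = pairCount r T S := by
  have : r = fun x y => r y x := by
    ext x y
    exact ⟨hr _ _, hr _ _⟩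
  unfold pairCount
  rw [Finset.sum_comm]
  conv_rhs => rw [this]

lemma pairCount_union_right [DecidableEq V] (S : Finset V) {T T' : Finset V}
    (h : Disjoint T T') :
    pairCount r S (T ∪ T') = pairCount r S T + pairCount r S T' := by
  unfold pairCount
  rw [← Finset.sum_add_distrib]
  exact Finset.sum_congr rfl fun x _ => Finset.sum_union h

lemma pairCount_union_left [DecidableEq V] (S : Finset V) {T T' : Finset V}
    (h : Disjoint T T') :
    pairCount r (T ∪ T') S = pairCount r T S + pairCount r T' S := by
  unfold pairCount
  exact Finset.sum_union h

lemma pairCount_mono {S S' T T' : Finset V} (hS : S ⊆ S') (hT : T ⊆ T') :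
    pairCount r S T ≤ pairCount r S' T' := by
  unfold pairCount
  refine (Finset.sum_le_sum_of_subset hS).trans (Finset.sum_le_sum fun x _ => ?_)
  exact Finset.sum_le_sum_of_subset hT

lemma pairCount_eq_zero {S T : Finset V} (h : ∀ x ∈ S, ∀ y ∈ T, ¬ r x y) :
    pairCount r S T = 0 := by
  unfold pairCount
  exact Finset.sum_eq_zero fun x hx => Finset.sum_eq_zero fun y hy => by simp [h x hx y hy]

lemma pairCount_empty_left (T : Finset V) : pairCount r ∅ T = 0 :=
  pairCount_eq_zero (by simp)

lemma pairCount_pos {S T : Finset V} {x y : V} (hx : x ∈ S) (hy : y ∈ T) (h : r x y) :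
    0 < pairCount r S T := by
  classical
  unfold pairCount
  refine lt_of_lt_of_le ?_ (Finset.single_le_sum
    (f := fun x => ∑ y ∈ T, if r x y then 1 else 0) (fun _ _ => Nat.zero_le _) hx)
  refine lt_of_lt_of_le ?_ (Finset.single_le_sum
    (f := fun y => if r x y then 1 else 0) (fun _ _ => Nat.zero_le _) hy)
  simp [h]

/-- A union bound for cuts. Three boxes are the most that is needed; an unneeded one is filled with
`∅`. -/
lemma pairCount_le_add_add [Fintype V] {S T S₁ T₁ S₂ T₂ S₃ T₃ : Finset V}
    (h : ∀ x ∈ S, ∀ y ∈ T, r x y → x ∈ S₁ ∧ y ∈ T₁ ∨ x ∈ S₂ ∧ y ∈ T₂ ∨ x ∈ S₃ ∧ y ∈ T₃) :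
    pairCount r S T ≤ pairCount r S₁ T₁ + pairCount r S₂ T₂ + pairCount r S₃ T₃ := by
  classical
  have key : ∀ S T : Finset V, pairCount r S T =
      ∑ x, ∑ y, if x ∈ S ∧ y ∈ T ∧ r x y then 1 else 0 := by
    intro S T
    simp [pairCount, ite_and, Finset.sum_ite_mem]
  simp only [key, ← Finset.sum_add_distrib]
  refine Finset.sum_le_sum fun x _ => Finset.sum_le_sum fun y _ => ?_
  have := h x
  have := fun hx => this hx y
  by_cases hxy : x ∈ S ∧ y ∈ T ∧ r x y
  · rcases this hxy.1 hxy.2.1 hxy.2.2 with h | h | h <;> simp [hxy, h] <;> omega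
  · simp [hxy]

/-- The handshake lemma: each unordered pair is counted in both orders, and the diagonal contributes
nothing. -/
lemma even_pairCount_self (hr : ∀ x y, r x y → r y x) (hi : ∀ x, ¬ r x x) (S : Finset V) :
    Even (pairCount r S S) := by
  classical
  induction S using Finset.induction_on with
  | empty => simp [pairCount]
  | insert a S ha ih =>
    have hd : Disjoint {a} S := by simpa using ha
    rw [Finset.insert_eq, pairCount_union_left _ hd, pairCount_union_right _ hd,
      pairCount_union_right _ hd, pairCount_comm hr S {a}]
    have : pairCount r {a} {a} = 0 := pairCount_eq_zero (by simpa using hi a)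
    obtain ⟨k, hk⟩ := ih
    exact ⟨pairCount r {a} S + k, by omega⟩

end Counting

/-! ### Degrees and cuts of a cycle -/

section Cycle

variable {V : Type} [Fintype V] {G : SimpleGraph V} {v : V} {C : G.Walk v v}

lemma pairCount_singleton_univ_eq_two (hC : C.IsCycle) {x : V} (hx : x ∈ C.support) :
    pairCount C.toSubgraph.Adj {x} Finset.univ = 2 := by
  classical
  rw [← hC.ncard_neighborSet_toSubgraph_eq_two hx]
  simp only [pairCount, Finset.sum_singleton, Finset.sum_boole, Nat.cast_id]
  rw [Set.ncard_eq_toFinset_card']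
  congr 1
  ext y
  simp

lemma pairCount_singleton_univ_eq_zero {x : V} (hx : x ∉ C.support) :
    pairCount C.toSubgraph.Adj {x} Finset.univ = 0 := by
  refine pairCount_eq_zero fun y hy z _ h => hx ?_
  rw [Finset.mem_singleton] at hy
  subst hy
  exact (C.mem_verts_toSubgraph).1 h.fst_mem

lemma pairCount_singleton_univ_le_two (hC : C.IsCycle) (x : V) :
    pairCount C.toSubgraph.Adj {x} Finset.univ ≤ 2 := by
  by_cases hx : x ∈ C.support
  · exact (pairCount_singleton_univ_eq_two hC hx).le
  · simp [pairCount_singleton_univ_eq_zero hx]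

lemma even_pairCount_univ (hC : C.IsCycle) (S : Finset V) :
    Even (pairCount C.toSubgraph.Adj S Finset.univ) := by
  classical
  have : pairCount C.toSubgraph.Adj S Finset.univ =
      ∑ x ∈ S, pairCount C.toSubgraph.Adj {x} Finset.univ := by simp [pairCount]
  rw [this]
  refine Finset.even_sum _ fun x _ => ?_
  by_cases hx : x ∈ C.support
  · simp [pairCount_singleton_univ_eq_two hC hx]
  · simp [pairCount_singleton_univ_eq_zero hx]

lemma exists_toSubgraph_adj_crossing {V : Type} {G : SimpleGraph V} {v : V} {C : G.Walk v v}
    (X : Set V) {x y : V} (hx : x ∈ X) (hxC : x ∈ C.support)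
    (hy : y ∉ X) (hyC : y ∈ C.support) : ∃ a ∈ X, ∃ b ∉ X, C.toSubgraph.Adj a b := by
  by_contra! hcon
  have hconn := C.toSubgraph_connected.preconnected
    ⟨x, C.mem_verts_toSubgraph.2 hxC⟩ ⟨y, C.mem_verts_toSubgraph.2 hyC⟩
  obtain ⟨p⟩ := hconn
  have key : ∀ (a b : C.toSubgraph.verts) (p : C.toSubgraph.coe.Walk a b), (a : V) ∈ X →
      (b : V) ∈ X := by
    intro a b p
    induction p with
    | nil => exact id
    | cons h _ ih =>
      intro ha
      refine ih ?_
      by_contra hb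
      exact hcon _ ha _ hb h
  exact hy (key _ _ p hx)

/-- The degree sum over `X` is even and so is the part of it internal to `X`, so the cut is even; it
is nonempty because the cycle is connected and has vertices on both sides. -/
lemma two_le_pairCount_compl [DecidableEq V] (hC : C.IsCycle) (X : Finset V) {x y : V}
    (hx : x ∈ X) (hxC : x ∈ C.support) (hy : y ∉ X) (hyC : y ∈ C.support) :
    2 ≤ pairCount C.toSubgraph.Adj X Xᶜ := by
  have h1 := even_pairCount_univ hC X
  have h2 : Even (pairCount C.toSubgraph.Adj X X) :=
    even_pairCount_self (fun _ _ h => h.symm) (fun _ h => h.ne rfl) X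
  rw [← Finset.union_compl X, pairCount_union_right _ disjoint_compl_right] at h1
  have h3 := (Nat.even_add.1 h1).1 h2
  obtain ⟨a, ha, b, hb, hab⟩ := exists_toSubgraph_adj_crossing (C := C) (X : Set V)
    (by simpa using hx) hxC (by simpa using hy) hyC
  have : 0 < pairCount C.toSubgraph.Adj X Xᶜ :=
    pairCount_pos (by simpa using ha) (by simpa using hb) hab
  obtain ⟨k, hk⟩ := h3
  omega

end Cycle

/-- A graph whose vertices other than `u`, `v` split off three nontrivial pieces has no dominating
cycle. -/
lemma not_hasDominatingCycle_of_separating_pair {G : FinGraph} (u v : G.V)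
    (X : Fin 3 → Finset G.V) (hdisj : ∀ i j, i ≠ j → Disjoint (X i) (X j))
    (hX : ∀ i, ∀ x ∈ X i, ∀ y, G.graph.Adj x y → y ∈ X i ∨ y = u ∨ y = v)
    (hedge : ∀ i, ∃ x ∈ X i, ∃ y ∈ X i, G.graph.Adj x y) : ¬ HasDominatingCycle G := by
  classical
  rintro ⟨w, C, hC, hdom⟩
  set r := C.toSubgraph.Adj with hr
  have hsymm : ∀ x y, r x y → r y x := fun _ _ h => h.symm
  have hmeet : ∀ i, ∃ x ∈ X i, x ∈ C.support := by
    intro i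
    obtain ⟨x, hx, y, hy, hxy⟩ := hedge i
    rcases hdom x y hxy with h | h
    exacts [⟨x, hx, h⟩, ⟨y, hy, h⟩]
  have hcross : ∀ i, 2 ≤ pairCount r {u} (X i) + pairCount r {v} (X i) := by
    intro i
    obtain ⟨x, hx, hxC⟩ := hmeet i
    obtain ⟨j, hj⟩ : ∃ j : Fin 3, j ≠ i := exists_ne i
    obtain ⟨y, hy, hyC⟩ := hmeet j
    have hyi : y ∉ X i := fun h => Finset.disjoint_left.1 (hdisj j i hj) hy h
    refine (two_le_pairCount_compl hC (X i) hx hxC hyi hyC).trans ?_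
    rw [pairCount_comm hsymm {u}, pairCount_comm hsymm {v}]
    refine (pairCount_le_add_add (S₁ := X i) (T₁ := {u}) (S₂ := X i) (T₂ := {v}) (S₃ := ∅)
      (T₃ := ∅) fun a ha b hb hab => ?_).trans (by rw [pairCount_empty_left, add_zero])
    rcases hX i a ha b hab.adj_sub with h | h | h
    · exact absurd h (Finset.mem_compl.1 hb)
    · simp [ha, h]
    · simp [ha, h]
  have hle : ∀ z, pairCount r {z} (X 0) + pairCount r {z} (X 1) + pairCount r {z} (X 2) ≤ 2 := by
    intro z
    rw [← pairCount_union_right _ (hdisj 0 1 (by decide)), ← pairCount_union_right]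
    · exact (pairCount_mono subset_rfl (Finset.subset_univ _)).trans
        (pairCount_singleton_univ_le_two hC z)
    · exact Finset.disjoint_union_left.2 ⟨hdisj _ _ (by decide), hdisj _ _ (by decide)⟩
  -- Three pieces ask for six edges, and the two hubs have cycle degree at most two each.
  have := hcross 0
  have := hcross 1
  have := hcross 2
  have := hle u
  have := hle v
  omega

/-- A graph made of three disjoint parts `X i ∪ {a i, b i}`, where parts are joined only by the
triangles on the `a i` and on the `b i` and every `X i` contains an edge, has no dominating
cycle. -/
lemma not_hasDominatingCycle_of_two_triangles {G : FinGraph} (a b : Fin 3 → G.V)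
    (X : Fin 3 → Finset G.V)
    (hab : ∀ i j, a i ≠ b j) (ha : Function.Injective a) (hb : Function.Injective b)
    (haX : ∀ i j, a i ∉ X j) (hbX : ∀ i j, b i ∉ X j)
    (hdisj : ∀ i j, i ≠ j → Disjoint (X i) (X j))
    (hcover : ∀ x, ∃ i, x = a i ∨ x = b i ∨ x ∈ X i)
    (hX : ∀ i, ∀ x ∈ X i, ∀ y, G.graph.Adj x y → y ∈ X i ∨ y = a i ∨ y = b i)
    (hcross : ∀ i j, ¬ (i ≠ j ∧ G.graph.Adj (a i) (b j)))
    (hedge : ∀ i, ∃ x ∈ X i, ∃ y ∈ X i, G.graph.Adj x y) : ¬ HasDominatingCycle G := by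
  classical
  rintro ⟨w, C, hC, hdom⟩
  set r := C.toSubgraph.Adj with hr
  have hsymm : ∀ x y, r x y → r y x := fun _ _ h => h.symm
  have hmeet : ∀ i, ∃ x ∈ X i, x ∈ C.support := by
    intro i
    obtain ⟨x, hx, y, hy, hxy⟩ := hedge i
    rcases hdom x y hxy with h | h
    exacts [⟨x, hx, h⟩, ⟨y, hy, h⟩]
  set A := Finset.univ.image a with hA
  set B := Finset.univ.image b with hB
  -- Used for the four sets between `X i` and `X i ∪ {a i, b i}`; each gives one cut inequality.
  have hout : ∀ i (Y : Finset G.V), (∀ x ∈ X i, x ∈ Y) →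
      (∀ x ∈ Y, x ∈ X i ∨ x = a i ∨ x = b i) → 2 ≤ pairCount r Y Yᶜ := by
    intro i Y hXY hY
    obtain ⟨x, hx, hxC⟩ := hmeet i
    obtain ⟨j, hj⟩ : ∃ j : Fin 3, j ≠ i := exists_ne i
    obtain ⟨y, hy, hyC⟩ := hmeet j
    refine two_le_pairCount_compl hC Y (hXY x hx) hxC (fun h => ?_) hyC
    rcases hY y h with h | h | h
    · exact Finset.disjoint_left.1 (hdisj j i hj) hy h
    · exact haX i j (h ▸ hy)
    · exact hbX i j (h ▸ hy)
  have hXa : ∀ i j, ∀ y ∈ X j, G.graph.Adj (a i) y → i = j := by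
    intro i j y hy h
    rcases hX j y hy _ h.symm with h | h | h
    · exact absurd h (haX i j)
    · exact ha h
    · exact absurd h (hab _ _)
  have hXb : ∀ i j, ∀ y ∈ X j, G.graph.Adj (b i) y → i = j := by
    intro i j y hy h
    rcases hX j y hy _ h.symm with h | h | h
    · exact absurd h (hbX i j)
    · exact absurd h.symm (hab _ _)
    · exact hb h
  have hna : ∀ i y, G.graph.Adj (a i) y → y ∈ A ∨ y ∈ X i ∨ y = b i := by
    intro i y h
    obtain ⟨j, rfl | rfl | hj⟩ := hcover y
    · exact Or.inl (by simp [hA])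
    · by_contra hcon
      refine hcross i j ⟨fun e => ?_, h⟩
      subst e
      simp at hcon
    · have := hXa i j y hj h
      subst this
      exact Or.inr (Or.inl hj)
  have hnb : ∀ i y, G.graph.Adj (b i) y → y ∈ B ∨ y ∈ X i ∨ y = a i := by
    intro i y h
    obtain ⟨j, rfl | rfl | hj⟩ := hcover y
    · by_contra hcon
      refine hcross j i ⟨fun e => ?_, h.symm⟩
      subst e
      simp at hcon
    · exact Or.inl (by simp [hB])
    · have := hXb i j y hj h
      subst this
      exact Or.inr (Or.inl hj)
  have haA : ∀ i, a i ∈ A := fun i => by simp [hA]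
  have hbB : ∀ i, b i ∈ B := fun i => by simp [hB]
  have hdegA : ∀ i, pairCount r {a i} A + pairCount r {a i} (X i) + pairCount r {a i} {b i} ≤ 2 := by
    intro i
    rw [← pairCount_union_right, ← pairCount_union_right]
    · exact (pairCount_mono subset_rfl (Finset.subset_univ _)).trans
        (pairCount_singleton_univ_le_two hC _)
    · simpa [hA, hab] using hbX i i
    · simpa [hA, Finset.disjoint_left] using fun j => haX j i
  have hdegB : ∀ i, pairCount r {b i} B + pairCount r {b i} (X i) + pairCount r {a i} {b i} ≤ 2 := by
    intro i
    rw [pairCount_comm hsymm {a i}, ← pairCount_union_right, ← pairCount_union_right]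
    · exact (pairCount_mono subset_rfl (Finset.subset_univ _)).trans
        (pairCount_singleton_univ_le_two hC _)
    · simpa [hB, fun j => (hab i j).symm] using haX i i
    · simpa [hB, Finset.disjoint_left] using fun j => hbX j i
  have hcutX : ∀ i, 2 ≤ pairCount r {a i} (X i) + pairCount r {b i} (X i) := by
    intro i
    rw [pairCount_comm hsymm {a i}, pairCount_comm hsymm {b i}]
    refine (hout i (X i) (fun x hx => hx) (fun x hx => Or.inl hx)).trans ?_
    refine (pairCount_le_add_add (S₁ := X i) (T₁ := {a i}) (S₂ := X i) (T₂ := {b i}) (S₃ := ∅)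
      (T₃ := ∅) fun x hx y hy hxy => ?_).trans (by rw [pairCount_empty_left, add_zero])
    rcases hX i x hx y hxy.adj_sub with h | h | h
    · exact absurd h (Finset.mem_compl.1 hy)
    · simp [hx, h]
    · simp [hx, h]
  have hcutB : ∀ i, 2 ≤ pairCount r {b i} B + pairCount r {a i} (X i) +
      pairCount r {a i} {b i} := by
    intro i
    rw [pairCount_comm hsymm {a i}, pairCount_comm hsymm {a i}]
    refine (hout i (insert (b i) (X i)) (fun x hx => by simp [hx])
      (fun x hx => (Finset.mem_insert.1 hx).symm.imp_right Or.inr)).trans ?_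
    refine pairCount_le_add_add fun x hx y hy hxy => ?_
    simp only [Finset.mem_compl, Finset.mem_insert, not_or] at hx hy
    rcases hx with rfl | hx
    · rcases hnb i y hxy.adj_sub with h | h | h
      · simp [h]
      · exact absurd h hy.2
      · simp [h]
    · rcases hX i x hx y hxy.adj_sub with h | h | h
      · exact absurd h hy.2
      · simp [hx, h]
      · exact absurd h hy.1
  have hcutA : ∀ i, 2 ≤ pairCount r {a i} A + pairCount r {b i} (X i) +
      pairCount r {a i} {b i} := by
    intro i
    rw [pairCount_comm hsymm {b i}]
    refine (hout i (insert (a i) (X i)) (fun x hx => by simp [hx])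
      (fun x hx => (Finset.mem_insert.1 hx).symm.imp_right Or.inl)).trans ?_
    refine pairCount_le_add_add fun x hx y hy hxy => ?_
    simp only [Finset.mem_compl, Finset.mem_insert, not_or] at hx hy
    rcases hx with rfl | hx
    · rcases hna i y hxy.adj_sub with h | h | h
      · simp [h]
      · exact absurd h hy.2
      · simp [h]
    · rcases hX i x hx y hxy.adj_sub with h | h | h
      · exact absurd h hy.2
      · exact absurd h hy.1
      · simp [hx, h]
  have hcutAB : ∀ i, 2 ≤ pairCount r {a i} A + pairCount r {b i} B := by
    intro i
    refine (hout i (insert (a i) (insert (b i) (X i))) (fun x hx => by simp [hx])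
      (fun x hx => ?_)).trans ?_
    · simp only [Finset.mem_insert] at hx
      tauto
    refine (pairCount_le_add_add (S₁ := {a i}) (T₁ := A) (S₂ := {b i}) (T₂ := B) (S₃ := ∅)
      (T₃ := ∅) fun x hx y hy hxy => ?_).trans (by rw [pairCount_empty_left, add_zero])
    simp only [Finset.mem_compl, Finset.mem_insert, not_or] at hx hy
    rcases hx with rfl | rfl | hx
    · rcases hna i y hxy.adj_sub with h | h | h
      · simp [h]
      · exact absurd h hy.2.2
      · exact absurd h hy.2.1
    · rcases hnb i y hxy.adj_sub with h | h | h
      · simp [h]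
      · exact absurd h hy.2.2
      · exact absurd h hy.1
    · rcases hX i x hx y hxy.adj_sub with h | h | h
      · exact absurd h hy.2.2
      · exact absurd h hy.1
      · exact absurd h hy.2.1
  -- Adding the two degree bounds to `hcutX` and `hcutAB` makes all four tight and excludes the edge
  -- `a i b i`; then `hcutA` and `hcutB` give equally many edges from `a i` and from `b i` into `X
  -- i`, namely one each.
  have hone : ∀ i, pairCount r {a i} A = 1 := by
    intro i
    have := hdegA i
    have := hdegB i
    have := hcutX i
    have := hcutA i
    have := hcutB i
    have := hcutAB i
    omega
  have hsum : pairCount r A A = 3 := by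
    have : pairCount r A A = ∑ i, pairCount r {a i} A := by
      simp only [pairCount, Finset.sum_singleton]
      rw [hA, Finset.sum_image fun _ _ _ _ h => ha h]
    simp [this, hone]
  have heven : Even (pairCount r A A) := even_pairCount_self hsymm (fun _ h => h.ne rfl) A
  rw [hsum] at heven
  exact absurd heven (by decide)

/-- A graph on at least three vertices is `2`-connected as soon as, for every vertex `w`, each
vertex predicate that is constant along the edges avoiding `w` is constant off `w`. -/
lemma twoConnected_of_forall_pred {G : FinGraph} (hG : 2 < G.order)
    (h : ∀ (w : G.V) (P : G.V → Prop),
      (∀ x y, G.graph.Adj x y → x ≠ w → y ≠ w → (P x ↔ P y)) →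
      ∀ x y, x ≠ w → y ≠ w → P x → P y) : TwoConnected G := by
  have hind : ∀ w : G.V, (G.graph.induce {w}ᶜ).Preconnected := by
    rintro w ⟨x, hx⟩ ⟨y, hy⟩
    -- The predicate used is reachability from `x` in the graph without `w`.
    obtain ⟨_, hreach⟩ := h w
      (fun z => ∃ hz : z ∈ ({w}ᶜ : Set G.V), (G.graph.induce {w}ᶜ).Reachable ⟨x, hx⟩ ⟨z, hz⟩)
      (fun a b hab ha hb => by
        have hadj : (G.graph.induce {w}ᶜ).Adj ⟨a, ha⟩ ⟨b, hb⟩ := hab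
        exact ⟨fun ⟨_, hr⟩ => ⟨hb, hr.trans hadj.reachable⟩,
          fun ⟨_, hr⟩ => ⟨ha, hr.trans hadj.symm.reachable⟩⟩)
      x y hx hy ⟨hx, SimpleGraph.Reachable.refl _⟩
    exact hreach
  have hthird : ∀ x y : G.V, ∃ w, w ≠ x ∧ w ≠ y := by
    classical
    intro x y
    by_contra! hcon
    have : (Finset.univ : Finset G.V) ⊆ {x, y} := by
      intro w _
      by_cases hw : w = x
      · simp [hw]
      · simp [hcon w hw]
    have := (Finset.card_le_card this).trans Finset.card_le_two
    rw [Finset.card_univ] at this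
    exact absurd hG (not_lt.2 this)
  have : Nonempty G.V := Fintype.card_pos_iff.1 (by unfold FinGraph.order at hG; omega)
  refine ⟨hG, { preconnected := fun x y => ?_ }, fun w => ?_⟩
  · obtain ⟨w, hwx, hwy⟩ := hthird x y
    exact (hind w ⟨x, hwx.symm⟩ ⟨y, hwy.symm⟩).map (SimpleGraph.Embedding.induce _).toHom
  · obtain ⟨z, hz, -⟩ := hthird w w
    exact { preconnected := hind w, nonempty := ⟨⟨z, hz⟩⟩ }

/-! ### Hub graphs and prisms -/

section Constructions

variable {K : Type}

/-- Adjacency of `hubGraph`. -/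
def HubAdj (e : Prop) (C : Fin 3 → SimpleGraph K) (att : Bool → Fin 3 → K → Prop) :
    Bool ⊕ Fin 3 × K → Bool ⊕ Fin 3 × K → Prop
  | .inl s, .inl t => s ≠ t ∧ e
  | .inl s, .inr p => att s p.1 p.2
  | .inr p, .inl s => att s p.1 p.2
  | .inr p, .inr q => p.1 = q.1 ∧ (C p.1).Adj p.2 q.2

/-- Three disjoint graphs `C i` and two further vertices (hubs), adjacent to each other if `e`
holds; the hub `s` is joined to those vertices `k` of `C i` for which `att s i k` holds. -/
def hubGraph (e : Prop) (C : Fin 3 → SimpleGraph K) (att : Bool → Fin 3 → K → Prop) :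
    SimpleGraph (Bool ⊕ Fin 3 × K) where
  Adj := HubAdj e C att
  symm := ⟨by
    rintro (s | p) (t | q) h
    · exact ⟨h.1.symm, h.2⟩
    · exact h
    · exact h
    · obtain ⟨h1, h2⟩ := h
      exact ⟨h1.symm, h1 ▸ h2.symm⟩⟩
  loopless := ⟨by
    rintro (s | p) h
    · exact h.1 rfl
    · exact h.2.ne rfl⟩

/-- Three disjoint copies of `C`, with a triangle on the three copies of `a` and a triangle on the
three copies of `b`. -/
def prismGraph (C : SimpleGraph K) (a b : K) : SimpleGraph (Fin 3 × K) where
  Adj p q := p.1 = q.1 ∧ C.Adj p.2 q.2 ∨ p.1 ≠ q.1 ∧ p.2 = q.2 ∧ (p.2 = a ∨ p.2 = b)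
  symm := ⟨by
    rintro p q (⟨h1, h2⟩ | ⟨h1, h2, h3⟩)
    · exact Or.inl ⟨h1.symm, h2.symm⟩
    · exact Or.inr ⟨h1.symm, h2.symm, h2 ▸ h3⟩⟩
  loopless := ⟨by
    rintro p (⟨_, h⟩ | ⟨h, _⟩)
    · exact h.ne rfl
    · exact h rfl⟩

/-- After the deletion of any vertex of `C`, every other vertex can still reach `T`. -/
def Linked (C : SimpleGraph K) (T : K → Prop) : Prop :=
  ∀ (w : K) (P : K → Prop), (∀ x y, C.Adj x y → x ≠ w → y ≠ w → (P x ↔ P y)) →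
    ∀ x, x ≠ w → P x → ∃ t, T t ∧ t ≠ w ∧ P t

lemma pred_iff_of_preconnected {V : Type*} {C : SimpleGraph V} (hC : C.Preconnected) {P : V → Prop}
    (hP : ∀ x y, C.Adj x y → (P x ↔ P y)) (x y : V) : P x ↔ P y := by
  obtain ⟨p⟩ := hC x y
  induction p with
  | nil => rfl
  | cons h _ ih => exact (hP _ _ h).trans ih

/-- If a hub is deleted, the other hub still meets every component. If a vertex of a component is
deleted, the hubs are connected through an intact component, and `Linked` connects the rest of the
damaged one to a hub. -/
lemma hubGraph_twoConnected [Fintype K] [Nonempty K] {e : Prop} {C : Fin 3 → SimpleGraph K}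
    {att : Bool → Fin 3 → K → Prop} (hC : ∀ i, (C i).Preconnected)
    (hatt : ∀ s i, ∃ k, att s i k) (hlink : ∀ i, Linked (C i) fun k => ∃ s, att s i k) :
    TwoConnected (.of (hubGraph e C att)) := by
  refine twoConnected_of_forall_pred ?_ ?_
  · have : 0 < Fintype.card K := Fintype.card_pos
    simp only [FinGraph.order, Fintype.card_sum, Fintype.card_bool, Fintype.card_prod,
      Fintype.card_fin]
    omega
  intro w P hP
  have hcomp : ∀ i s, (∀ k, (.inr (i, k) : Bool ⊕ Fin 3 × K) ≠ w) → .inl s ≠ w →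
      ∀ k, P (.inr (i, k)) ↔ P (.inl s) := by
    intro i s hi hs k
    obtain ⟨k', hk'⟩ := hatt s i
    refine (pred_iff_of_preconnected (hC i) (P := fun k => P (.inr (i, k)))
      (fun x y hxy => hP _ _ ⟨rfl, hxy⟩ (hi x) (hi y)) k k').trans ?_
    exact hP (.inr (i, k')) (.inl s) hk' (hi _) hs
  suffices h : ∃ c : Prop, ∀ x, x ≠ w → (P x ↔ c) by
    obtain ⟨c, hc⟩ := h
    exact fun x y hx hy hPx => (hc y hy).2 ((hc x hx).1 hPx)
  rcases w with s | ⟨i, k₀⟩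
  · have hs : (.inl (!s) : Bool ⊕ Fin 3 × K) ≠ .inl s := by simp
    refine ⟨P (.inl (!s)), ?_⟩
    rintro (t | ⟨i, k⟩) hx
    · have : t = !s := by
        have : t ≠ s := fun h => hx (h ▸ rfl)
        revert this
        cases s <;> cases t <;> simp
      rw [this]
    · exact hcomp i _ (by simp) hs k
  · obtain ⟨j, hj⟩ : ∃ j : Fin 3, j ≠ i := exists_ne i
    obtain ⟨k₁⟩ := ‹Nonempty K›
    have hne : ∀ j, j ≠ i → ∀ k, (.inr (j, k) : Bool ⊕ Fin 3 × K) ≠ .inr (i, k₀) := by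
      intro j hj k h
      exact hj (Prod.ext_iff.1 (Sum.inr.inj h)).1
    have hhub : ∀ s, P (.inl s) ↔ P (.inl true) := fun s =>
      (hcomp j s (hne j hj) (by simp) k₁).symm.trans (hcomp j true (hne j hj) (by simp) k₁)
    refine ⟨P (.inl true), ?_⟩
    rintro (t | ⟨i', k⟩) hx
    · exact hhub t
    · by_cases hi : i' = i
      · subst hi
        have hne' : ∀ x, x ≠ k₀ → (.inr (i', x) : Bool ⊕ Fin 3 × K) ≠ .inr (i', k₀) := by
          intro x hx h
          exact hx (Prod.ext_iff.1 (Sum.inr.inj h)).2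
        by_contra hcon
        obtain ⟨t, ⟨s, hs⟩, htne, ht⟩ := hlink i' k₀
          (fun k => ¬ (P (.inr (i', k)) ↔ P (.inl true)))
          (fun x y hxy hx hy => by
            rw [hP (.inr (i', x)) (.inr (i', y)) ⟨rfl, hxy⟩ (hne' x hx) (hne' y hy)])
          k (fun h => hx (h ▸ rfl)) hcon
        exact ht ((hP (.inr (i', t)) (.inl s) hs (hne' t htne) (by simp)).trans (hhub s))
      · exact hcomp i' _ (hne i' hi) (by simp) k

lemma hubGraph_not_hasDominatingCycle [Fintype K] {e : Prop} {C : Fin 3 → SimpleGraph K}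
    {att : Bool → Fin 3 → K → Prop} (hedge : ∀ i, ∃ x y, (C i).Adj x y) :
    ¬ HasDominatingCycle (.of (hubGraph e C att)) := by
  classical
  refine not_hasDominatingCycle_of_separating_pair (G := .of (hubGraph e C att))
    (.inl true) (.inl false) (fun i => Finset.univ.image fun k => .inr (i, k)) ?_ ?_ ?_
  · intro i j hij
    simp [Finset.disjoint_left, hij.symm]
  · intro i x hx y hxy
    obtain ⟨k, rfl⟩ : ∃ k, .inr (i, k) = x := by simpa using hx
    rcases y with (_ | _) | ⟨j, l⟩
    · simp
    · simp
    · left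
      obtain ⟨h, -⟩ := hxy
      simpa using h
  · intro i
    obtain ⟨x, y, hxy⟩ := hedge i
    exact ⟨.inr (i, x), by simp, .inr (i, y), by simp, rfl, hxy⟩

/-- The two copies of `C` not hit by the deletion stay connected to each other through the triangle
on `a`; `Linked` brings the rest of the damaged copy to a surviving triangle vertex, from which a
triangle edge leads out. -/
lemma prismGraph_twoConnected [Fintype K] {C : SimpleGraph K} {a b : K}
    (hC : C.Preconnected) (hlink : Linked C fun k => k = a ∨ k = b) :
    TwoConnected (.of (prismGraph C a b)) := by
  refine twoConnected_of_forall_pred ?_ ?_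
  · have : 0 < Fintype.card K := Fintype.card_pos_iff.2 ⟨a⟩
    simp only [FinGraph.order, Fintype.card_prod, Fintype.card_fin]
    omega
  rintro ⟨i, k₀⟩ P hP
  have hne : ∀ j, j ≠ i → ∀ k, (j, k) ≠ (i, k₀) := fun j hj k h => hj (Prod.ext_iff.1 h).1
  have hcomp : ∀ j, j ≠ i → ∀ k l, P (j, k) ↔ P (j, l) := fun j hj k l =>
    pred_iff_of_preconnected hC (P := fun k => P (j, k))
      (fun x y hxy => hP _ _ (Or.inl ⟨rfl, hxy⟩) (hne j hj x) (hne j hj y)) k l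
  obtain ⟨j, hj⟩ : ∃ j : Fin 3, j ≠ i := exists_ne i
  have hother : ∀ j', j' ≠ i → ∀ k, P (j', k) ↔ P (j, a) := by
    intro j' hj' k
    refine (hcomp j' hj' k a).trans ?_
    by_cases h : j' = j
    · rw [h]
    · exact hP _ _ (Or.inr ⟨h, rfl, Or.inl rfl⟩) (hne j' hj' a) (hne j hj a)
  suffices h : ∀ x, x ≠ (i, k₀) → (P x ↔ P (j, a)) from
    fun x y hx hy hPx => (h y hy).2 ((h x hx).1 hPx)
  rintro ⟨i', k⟩ hx
  by_cases hi : i' = i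
  · subst hi
    have hne' : ∀ x, x ≠ k₀ → (i', x) ≠ (i', k₀) := fun x hx h => hx (Prod.ext_iff.1 h).2
    by_contra hcon
    obtain ⟨t, hab, htne, ht⟩ := hlink k₀
      (fun k => ¬ (P (i', k) ↔ P (j, a)))
      (fun x y hxy hx hy => by
        rw [hP (i', x) (i', y) (Or.inl ⟨rfl, hxy⟩) (hne' x hx) (hne' y hy)])
      k (fun h => hx (h ▸ rfl)) hcon
    exact ht ((hP (i', t) (j, t) (Or.inr ⟨hj.symm, rfl, hab⟩) (hne' t htne)
      (hne j hj t)).trans (hother j hj t))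
  · exact hother i' hi k

lemma prismGraph_not_hasDominatingCycle [Fintype K] {C : SimpleGraph K} {a b : K} (hab : a ≠ b)
    (hedge : ∃ x y, C.Adj x y ∧ x ≠ a ∧ x ≠ b ∧ y ≠ a ∧ y ≠ b) :
    ¬ HasDominatingCycle (.of (prismGraph C a b)) := by
  classical
  refine not_hasDominatingCycle_of_two_triangles (G := .of (prismGraph C a b))
    (fun i => (i, a)) (fun i => (i, b))
    (fun i => Finset.univ.filter fun p => p.1 = i ∧ p.2 ≠ a ∧ p.2 ≠ b) ?_ ?_ ?_ ?_ ?_ ?_ ?_ ?_ ?_ ?_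
  · simp [hab]
  · exact fun i j h => (Prod.ext_iff.1 h).1
  · exact fun i j h => (Prod.ext_iff.1 h).1
  · simp
  · simp
  · intro i j hij
    simp only [Finset.disjoint_left, Finset.mem_filter]
    rintro p ⟨_, rfl, _⟩ ⟨_, h, _⟩
    exact hij h
  · rintro ⟨i, k⟩
    refine ⟨i, ?_⟩
    by_cases ha : k = a
    · simp [ha]
    · by_cases hb : k = b
      · simp [hb]
      · simp [ha, hb]
  · rintro i ⟨i', k⟩ hx ⟨j, l⟩ hxy
    simp only [Finset.mem_filter, Finset.mem_univ, true_and] at hx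
    obtain ⟨rfl, hka, hkb⟩ := hx
    rcases hxy with ⟨h, -⟩ | ⟨-, -, h⟩
    · dsimp only at h
      subst h
      by_cases ha : l = a
      · simp [ha]
      · by_cases hb : l = b
        · simp [hb]
        · simp [ha, hb]
    · exact absurd h (by simp [hka, hkb])
  · rintro i j ⟨hij, ⟨h, -⟩ | ⟨-, h, -⟩⟩
    · exact hij h
    · exact hab h
  · intro i
    obtain ⟨x, y, hxy, hxa, hxb, hya, hyb⟩ := hedge
    exact ⟨(i, x), by simp [hxa, hxb], (i, y), by simp [hya, hyb], Or.inl ⟨rfl, hxy⟩⟩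

/-- The star with centre `0` on `n + 4` vertices. -/
def star (n : ℕ) : SimpleGraph (Fin (n + 4)) :=
  SimpleGraph.fromRel fun x _ => x = 0

lemma star_adj {n : ℕ} {x y : Fin (n + 4)} : (star n).Adj x y ↔ x ≠ y ∧ (x = 0 ∨ y = 0) := by
  simp [star]

lemma star_preconnected (n : ℕ) : (star n).Preconnected := by
  have h : ∀ x, (star n).Reachable 0 x := by
    intro x
    by_cases hx : x = 0
    · rw [hx]
    · exact (star_adj.2 ⟨Ne.symm hx, Or.inl rfl⟩).reachable
  exact fun x y => (h x).symm.trans (h y)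

/-- Only the centre needs an argument: it has at least three leaves, so one survives. -/
lemma linked_star (n : ℕ) : Linked (star n) fun k => k ≠ 0 := by
  intro w P hP x hx hPx
  by_cases h0 : x = 0
  · subst h0
    obtain ⟨t, ht0, htw⟩ : ∃ t : Fin (n + 4), t ≠ 0 ∧ t ≠ w := by
      by_cases hw : w = 1
      · exact ⟨⟨2, by omega⟩, by simp [Fin.ext_iff], by simp [hw, Fin.ext_iff]⟩
      · exact ⟨1, by simp, Ne.symm hw⟩
    exact ⟨t, ht0, htw, (hP 0 t (star_adj.2 ⟨ht0.symm, Or.inl rfl⟩) hx htw).1 hPx⟩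
  · exact ⟨x, h0, hx, hPx⟩

lemma linked_of_forall {C : SimpleGraph K} {T : K → Prop} (h : ∀ k, T k) : Linked C T :=
  fun _ _ _ x hx hPx => ⟨x, h x, hx, hPx⟩

lemma linked_of_adj_two {C : SimpleGraph K} {a b : K} (hab : a ≠ b)
    (h : ∀ k, k ≠ a → k ≠ b → C.Adj k a ∧ C.Adj k b) : Linked C fun k => k = a ∨ k = b := by
  intro w P hP x hx hPx
  by_cases hxa : x = a
  · exact ⟨x, Or.inl hxa, hx, hPx⟩
  by_cases hxb : x = b
  · exact ⟨x, Or.inr hxb, hx, hPx⟩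
  obtain ⟨h1, h2⟩ := h x hxa hxb
  by_cases hw : a = w
  · have hb : b ≠ w := fun hb => hab (hw.trans hb.symm)
    exact ⟨b, Or.inr rfl, hb, (hP _ _ h2 hx hb).1 hPx⟩
  · exact ⟨a, Or.inl rfl, hw, (hP _ _ h1 hx hw).1 hPx⟩

/-- The deleted vertex leaves one side of `x` intact, so `x` reaches the end of the path on that
side. -/
lemma linked_pathGraph (n : ℕ) :
    Linked (SimpleGraph.pathGraph (n + 1)) fun k => k = 0 ∨ k = Fin.last n := by
  intro w P hP x hx hPx
  have hadj : ∀ j (hj : j + 1 < n + 1),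
      (SimpleGraph.pathGraph (n + 1)).Adj ⟨j, by omega⟩ ⟨j + 1, hj⟩ := by
    intro j hj
    simp [SimpleGraph.pathGraph_adj]
  rcases lt_or_gt_of_ne hx with h | h
  · have key : ∀ j (hj : j < n + 1), (⟨j, hj⟩ : Fin (n + 1)) < w → P ⟨j, hj⟩ → P 0 := by
      intro j
      induction j with
      | zero => exact fun _ _ h => h
      | succ j ih =>
        intro hj hlt hPj
        have hlt' : (⟨j, by omega⟩ : Fin (n + 1)) < w :=
          lt_trans (by simp [Fin.lt_def]) hlt
        exact ih _ hlt' ((hP _ _ (hadj j hj) hlt'.ne hlt.ne).2 hPj)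
    exact ⟨0, Or.inl rfl, (lt_of_le_of_lt (Fin.zero_le _) h).ne, key x.1 x.2 h hPx⟩
  · have key : ∀ d j (hj : j < n + 1), j + d = n → w < (⟨j, hj⟩ : Fin (n + 1)) → P ⟨j, hj⟩ →
        P (Fin.last n) := by
      intro d
      induction d with
      | zero =>
        intro j hj hd _ hPj
        have : (⟨j, hj⟩ : Fin (n + 1)) = Fin.last n := Fin.ext (by simpa using hd)
        rwa [← this]
      | succ d ih =>
        intro j hj hd hlt hPj
        have hlt' : w < (⟨j + 1, by omega⟩ : Fin (n + 1)) :=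
          lt_trans hlt (by simp [Fin.lt_def])
        exact ih _ _ (by omega) hlt' ((hP _ _ (hadj j (by omega)) hlt.ne' hlt'.ne').1 hPj)
    exact ⟨Fin.last n, Or.inr rfl, (lt_of_lt_of_le h (Fin.le_last _)).ne',
      key (n - x) x.1 x.2 (by omega) h hPx⟩

end Constructions

/-! ### Finite search over vertex classes -/

section Search

/-- A new vertex of index `p` and class `x` is compatible with the classes of the earlier vertices,
listed in reverse order. -/
def compatible (adjC nonC t : ℕ → ℕ → Bool) (p x : ℕ) : List ℕ → Bool
  | [] => true
  | y :: ys => (if t p ys.length then adjC x y else nonC x y) && compatible adjC nonC t p x ys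

/-- Backtracking search for an assignment of classes below `c` to `k` further vertices. -/
def extendable (adjC nonC t : ℕ → ℕ → Bool) (c : ℕ) : ℕ → List ℕ → Bool
  | 0, _ => true
  | k + 1, l => (List.range c).any fun x =>
      compatible adjC nonC t l.length x l && extendable adjC nonC t c k (x :: l)

/-- The first `p` values of `g`, in reverse order. -/
def initialValues (g : ℕ → ℕ) : ℕ → List ℕ
  | 0 => []
  | p + 1 => g p :: initialValues g p

lemma length_initialValues (g : ℕ → ℕ) (p : ℕ) : (initialValues g p).length = p := by
  induction p with
  | zero => rfl
  | succ p ih => simp [initialValues, ih]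

/-- Completeness of the search: the branch that follows `g` is never pruned. A negative answer
therefore rules out every assignment. -/
lemma extendable_of_assignment {adjC nonC t : ℕ → ℕ → Bool} {c n : ℕ} (g : ℕ → ℕ)
    (hc : ∀ p < n, g p < c)
    (hg : ∀ p < n, ∀ q < p, (if t p q then adjC (g p) (g q) else nonC (g p) (g q)) = true) :
    extendable adjC nonC t c n [] = true := by
  have hcomp : ∀ p < n, ∀ m ≤ p, compatible adjC nonC t p (g p) (initialValues g m) = true := by
    intro p hp m
    induction m with
    | zero => exact fun _ => rfl
    | succ m ih =>
      intro hm
      simp only [initialValues, compatible, length_initialValues, Bool.and_eq_true]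
      exact ⟨hg p hp m hm, ih (by omega)⟩
  have key : ∀ k p, p + k = n → extendable adjC nonC t c k (initialValues g p) = true := by
    intro k
    induction k with
    | zero => exact fun _ _ => rfl
    | succ k ih =>
      intro p hp
      simp only [extendable, List.any_eq_true, List.mem_range, length_initialValues,
        Bool.and_eq_true]
      exact ⟨g p, hc p (by omega), hcomp p (by omega) p le_rfl, ih (p + 1) (by omega)⟩
  exact key n 0 (by omega)

/-- An induced embedding would assign a class to each vertex of `G`. The relations `adjC` and `nonC`
need only be necessary conditions, so the test sees classes and not the size of `F`; it may allow
more than `F` does, which is harmless for a negative conclusion. -/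
lemma not_isIndContained_of_search {V W : Type} {G : SimpleGraph V} {F : SimpleGraph W}
    (cls : W → ℕ) (c : ℕ) (adjC nonC : ℕ → ℕ → Bool) (hcls : ∀ x, cls x < c)
    (hadj : ∀ x y, F.Adj x y → adjC (cls x) (cls y) = true)
    (hnon : ∀ x y, x ≠ y → ¬ F.Adj x y → nonC (cls x) (cls y) = true)
    {n : ℕ} (t : ℕ → ℕ → Bool) (e : Fin n → V)
    (he : ∀ p q : Fin n, q < p → e p ≠ e q ∧ (t p q = true ↔ G.Adj (e p) (e q)))
    (hsearch : extendable adjC nonC t c n [] = false) : ¬ G ⊴ F := by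
  rintro ⟨φ⟩
  have := extendable_of_assignment (adjC := adjC) (nonC := nonC) (t := t) (c := c) (n := n)
    (fun p => if h : p < n then cls (φ (e ⟨p, h⟩)) else 0)
    (fun p hp => by simpa [hp] using hcls _)
    (fun p hp q hq => by
      obtain ⟨h1, h2⟩ := he ⟨p, hp⟩ ⟨q, hq.trans hp⟩ hq
      have h3 := φ.map_adj_iff (v := e ⟨p, hp⟩) (w := e ⟨q, hq.trans hp⟩)
      simp only [hp, hq.trans hp, dite_true]
      by_cases h : t p q = true
      · rw [if_pos h]
        exact hadj _ _ (h3.2 (h2.1 h))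
      · rw [if_neg h]
        exact hnon _ _ (fun heq => h1 (φ.injective heq)) fun h' => h (h2.2 (h3.1 h')))
  rw [hsearch] at this
  exact Bool.false_ne_true this

end Search

/-! ### The obstruction families and their classes -/

section Families

/-- Two hubs (adjacent if `e`) and three components, the `i`-th being a star if `st i` and complete
otherwise; both hubs are joined to the centre of component `i` if `att i true`, and to its other
vertices if `att i false`. -/
def hubFamily (e : Bool) (st : ℕ → Bool) (att : ℕ → Bool → Bool) (n : ℕ) :
    SimpleGraph (Bool ⊕ Fin 3 × Fin (n + 4)) :=
  hubGraph (e = true) (fun i => if st i then star n else ⊤)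
    fun _ i k => att i (decide (k = 0)) = true

/-- Three complete graphs, or complete graphs without the edge `ab` if `e` is false, with triangles
on the copies of `a` and on the copies of `b`. -/
def cliquePrism (e : Bool) (n : ℕ) : SimpleGraph (Fin 3 × Fin (n + 4)) :=
  prismGraph (if e then ⊤ else (⊤ : SimpleGraph (Fin (n + 4))).deleteEdges {s(0, 1)}) 0 1

/-- Two vertices joined by three long paths. -/
def thetaFamily (n : ℕ) : SimpleGraph (Bool ⊕ Fin 3 × Fin (n + 4)) :=
  hubGraph False (fun _ => SimpleGraph.pathGraph (n + 4))
    fun s _ k => k = if s then 0 else Fin.last (n + 3)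

/-- Two triangles joined by three long paths. -/
def pathPrism (n : ℕ) : SimpleGraph (Fin 3 × Fin (n + 4)) :=
  prismGraph (SimpleGraph.pathGraph (n + 4)) 0 (Fin.last (n + 3))

/-- The graph is `2`-connected, has no dominating cycle, and has at least `n` vertices. -/
def IsObstruction (n : ℕ) (G : FinGraph) : Prop :=
  TwoConnected G ∧ ¬ HasDominatingCycle G ∧ n ≤ G.order

lemma thetaFamily_isObstruction (n : ℕ) : IsObstruction n (.of (thetaFamily n)) := by
  refine ⟨hubGraph_twoConnected (fun _ => SimpleGraph.pathGraph_preconnected _)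
    (fun s _ => ⟨_, rfl⟩) (fun _ => ?_), hubGraph_not_hasDominatingCycle fun _ => ⟨0, 1, ?_⟩, ?_⟩
  · simpa [or_comm] using linked_pathGraph (n + 3)
  · simp [SimpleGraph.pathGraph_adj]
  · simp [FinGraph.order]
    omega

lemma pathPrism_isObstruction (n : ℕ) : IsObstruction n (.of (pathPrism n)) := by
  refine ⟨prismGraph_twoConnected (SimpleGraph.pathGraph_preconnected _) (linked_pathGraph _),
    prismGraph_not_hasDominatingCycle ?_ ⟨1, ⟨2, by omega⟩, ?_⟩, ?_⟩
  · simp [Fin.ext_iff]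
  · simp [SimpleGraph.pathGraph_adj, Fin.ext_iff]
  · simp [FinGraph.order]
    omega

lemma cliquePrism_isObstruction (e : Bool) (n : ℕ) : IsObstruction n (.of (cliquePrism e n)) := by
  have hne : (0 : Fin (n + 4)) ≠ 1 := by simp
  have hl : Linked (if e then ⊤ else (⊤ : SimpleGraph (Fin (n + 4))).deleteEdges {s(0, 1)})
      fun k => k = 0 ∨ k = 1 := by
    refine linked_of_adj_two hne fun k h0 h1 => ?_
    cases e <;> simp [h0, h1]
  refine ⟨prismGraph_twoConnected ?_ hl,
    prismGraph_not_hasDominatingCycle hne ⟨⟨2, by omega⟩, ⟨3, by omega⟩, ?_⟩, ?_⟩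
  · cases e
    · have h : ∀ k : Fin (n + 4), ((⊤ : SimpleGraph (Fin (n + 4))).deleteEdges
          {s(0, 1)}).Reachable k ⟨2, by omega⟩ := by
        intro k
        by_cases hk : k = ⟨2, by omega⟩
        · rw [hk]
        · refine SimpleGraph.Adj.reachable ?_
          simp [hk, Fin.ext_iff, -Fin.val_eq_zero_iff]
      exact fun x y => (h x).trans (h y).symm
    · exact SimpleGraph.preconnected_top
  · cases e <;> simp [Fin.ext_iff, -Fin.val_eq_zero_iff]
  · simp [FinGraph.order]
    omega

/-- The centre may be left unattached only in a star, where after any deletion it still reaches a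
leaf and hence a hub. -/
lemma hubFamily_isObstruction {e : Bool} {st : ℕ → Bool} {att : ℕ → Bool → Bool}
    (hatt : ∀ i < 3, att i false = true)
    (hst : ∀ i < 3, att i true = true ∨ st i = true) (n : ℕ) :
    IsObstruction n (.of (hubFamily e st att n)) := by
  refine ⟨hubGraph_twoConnected (fun i => ?_)
    (fun _ i => ⟨1, by simpa using hatt i i.2⟩) (fun i => ?_),
    hubGraph_not_hasDominatingCycle fun i => ⟨0, 1, ?_⟩, ?_⟩
  · split_ifs
    · exact star_preconnected n
    · exact SimpleGraph.preconnected_top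
  · rcases hst i i.2 with h | h
    · refine linked_of_forall fun k => ⟨true, ?_⟩
      by_cases hk : k = 0
      · simp [hk, h]
      · simp [hk, hatt i i.2]
    · rw [if_pos h]
      intro w P hP x hx hPx
      obtain ⟨t, ht0, ht⟩ := linked_star n w P hP x hx hPx
      exact ⟨t, ⟨true, by simp [ht0, hatt i i.2]⟩, ht⟩
  · split_ifs <;> simp [star_adj]
  · simp [FinGraph.order]
    omega

/-- The class of a vertex of `hubFamily`: the hubs are `0`, `1`, the centre and the other vertices
of the component `i` are `2 i + 2` and `2 i + 3`. -/
def hubClass {n : ℕ} : Bool ⊕ Fin 3 × Fin (n + 4) → ℕ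
  | .inl s => if s then 1 else 0
  | .inr p => 2 * p.1 + if p.2 = 0 then 2 else 3

/-- Adjacency in `hubFamily`, in terms of classes. -/
def hubAdjClass (e : Bool) (st : ℕ → Bool) (att : ℕ → Bool → Bool) (c d : ℕ) : Bool :=
  if c < 2 then if d < 2 then e && c != d else att (d / 2 - 1) (d % 2 == 0)
  else if d < 2 then att (c / 2 - 1) (c % 2 == 0)
  else c / 2 == d / 2 && (!st (c / 2 - 1) || c % 2 != d % 2)

/-- Non-adjacency of distinct vertices in `hubFamily`, in terms of classes. -/
def hubNonClass (e : Bool) (st : ℕ → Bool) (att : ℕ → Bool → Bool) (c d : ℕ) : Bool :=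
  if c < 2 then if d < 2 then !e && c != d else !att (d / 2 - 1) (d % 2 == 0)
  else if d < 2 then !att (c / 2 - 1) (c % 2 == 0)
  else c / 2 != d / 2 || (st (c / 2 - 1) && c % 2 == 1 && d % 2 == 1)

lemma hubClass_inr {n : ℕ} (i : Fin 3) (k : Fin (n + 4)) :
    ¬ hubClass (.inr (i, k)) < 2 ∧ hubClass (.inr (i, k)) / 2 = i + 1 ∧
      hubClass (.inr (i, k)) % 2 = if k = 0 then 0 else 1 := by
  simp only [hubClass]
  split_ifs <;> omega

lemma hubClass_inl {n : ℕ} (s : Bool) : hubClass (.inl s : Bool ⊕ Fin 3 × Fin (n + 4)) < 2 := by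
  cases s <;> simp [hubClass]

/-- There are eight classes: two hubs, and centre and non-centre in each of three components. A
repeated hub or star centre satisfies neither relation, so those classes are used at most once. -/
lemma hubFamily_search {V : Type} {G : SimpleGraph V} (e : Bool) (st : ℕ → Bool)
    (att : ℕ → Bool → Bool) (m : ℕ) {n : ℕ} (t : ℕ → ℕ → Bool) (v : Fin n → V)
    (hv : ∀ p q : Fin n, q < p → v p ≠ v q ∧ (t p q = true ↔ G.Adj (v p) (v q)))
    (hsearch : extendable (hubAdjClass e st att) (hubNonClass e st att) t 8 n [] = false) :
    ¬ G ⊴ hubFamily e st att m := by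
  have hz : ∀ k : Fin (m + 4), ((if k = 0 then 0 else 1 : ℕ) == 0) = decide (k = 0) := by
    intro k
    split_ifs with h <;> simp [h]
  refine not_isIndContained_of_search hubClass 8 _ _ ?_ ?_ ?_ t v hv hsearch
  · rintro (s | ⟨i, k⟩)
    · exact (hubClass_inl s).trans (by norm_num)
    · obtain ⟨_, h, _⟩ := hubClass_inr i k
      omega
  · rintro (s | ⟨i, k⟩) (s' | ⟨j, l⟩) h
    · obtain ⟨h1, h2⟩ := h
      revert h1
      cases s <;> cases s' <;> simp [hubAdjClass, hubClass, h2]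
    · obtain ⟨h1, h2, h3⟩ := hubClass_inr j l
      have h' : att j (decide (l = 0)) = true := h
      rw [hubAdjClass, if_pos (hubClass_inl (n := m) s), if_neg h1, h2, h3, hz]
      simpa using h'
    · obtain ⟨h1, h2, h3⟩ := hubClass_inr i k
      have h' : att i (decide (k = 0)) = true := h
      rw [hubAdjClass, if_neg h1, if_pos (hubClass_inl (n := m) s'), h2, h3, hz]
      simpa using h'
    · obtain ⟨h1, h2, h3⟩ := hubClass_inr i k
      obtain ⟨h1', h2', h3'⟩ := hubClass_inr j l
      obtain ⟨rfl, h⟩ := h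
      dsimp only at h
      simp only [hubAdjClass, h1, h2, h3, h1', h2', h3']
      cases hs : st i
      · simp [hs]
      · rw [if_pos hs] at h
        rw [star_adj] at h
        by_cases hk : k = 0 <;> by_cases hl : l = 0 <;> simp_all
  · rintro (s | ⟨i, k⟩) (s' | ⟨j, l⟩) hne h
    · have h1 : s ≠ s' := fun h => hne (h ▸ rfl)
      have h2 : e = false := by
        by_contra he
        exact h ⟨h1, by simpa using he⟩
      revert h1
      cases s <;> cases s' <;> simp [hubNonClass, hubClass, h2]
    · obtain ⟨h1, h2, h3⟩ := hubClass_inr j l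
      have h' : ¬ att j (decide (l = 0)) = true := h
      rw [hubNonClass, if_pos (hubClass_inl (n := m) s), if_neg h1, h2, h3, hz]
      simpa using h'
    · obtain ⟨h1, h2, h3⟩ := hubClass_inr i k
      have h' : ¬ att i (decide (k = 0)) = true := h
      rw [hubNonClass, if_neg h1, if_pos (hubClass_inl (n := m) s'), h2, h3, hz]
      simpa using h'
    · obtain ⟨h1, h2, h3⟩ := hubClass_inr i k
      obtain ⟨h1', h2', h3'⟩ := hubClass_inr j l
      simp only [hubNonClass, h1, h2, h3, h1', h2', h3']
      by_cases hij : i = j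
      · subst hij
        have hkl : k ≠ l := fun h => hne (h ▸ rfl)
        have h' : ¬ (if st i then star m else ⊤).Adj k l := fun hh => h ⟨rfl, hh⟩
        cases hs : st i
        · simp [hs, hkl] at h'
        · rw [if_pos hs, star_adj] at h'
          by_cases hk : k = 0 <;> by_cases hl : l = 0 <;> simp_all
      · simp [Fin.ext_iff] at hij
        simp [hij]

/-- The class of a vertex of `cliquePrism`. -/
def prismClass {n : ℕ} (p : Fin 3 × Fin (n + 4)) : ℕ := 3 * p.1 + min p.2.1 2

/-- Adjacency in `cliquePrism`, in terms of classes. -/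
def prismAdjClass (e : Bool) (c d : ℕ) : Bool :=
  if c / 3 == d / 3 then (c % 3 == 2 || c % 3 != d % 3) && (e || c % 3 == 2 || d % 3 == 2)
  else c % 3 == d % 3 && c % 3 != 2

/-- Non-adjacency of distinct vertices in `cliquePrism`, in terms of classes. -/
def prismNonClass (e : Bool) (c d : ℕ) : Bool :=
  if c / 3 == d / 3 then !e && c % 3 != d % 3 && c % 3 != 2 && d % 3 != 2
  else c % 3 != d % 3 || c % 3 == 2

/-- Nine classes: in each copy the two triangle vertices, which cannot be repeated, and all
remaining vertices together. -/
lemma cliquePrism_search {V : Type} {G : SimpleGraph V} (e : Bool)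
    (m : ℕ) {n : ℕ} (t : ℕ → ℕ → Bool) (v : Fin n → V)
    (hv : ∀ p q : Fin n, q < p → v p ≠ v q ∧ (t p q = true ↔ G.Adj (v p) (v q)))
    (hsearch : extendable (prismAdjClass e) (prismNonClass e) t 9 n [] = false) :
    ¬ G ⊴ cliquePrism e m := by
  have hdiv : ∀ p : Fin 3 × Fin (m + 4), prismClass p / 3 = p.1 := by
    intro p
    simp only [prismClass]
    omega
  have hmod : ∀ p : Fin 3 × Fin (m + 4), prismClass p % 3 = min p.2.1 2 := by
    intro p
    simp only [prismClass]
    omega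
  refine not_isIndContained_of_search prismClass 9 _ _ ?_ ?_ ?_ t v hv hsearch
  · intro p
    simp only [prismClass]
    omega
  · rintro ⟨i, k⟩ ⟨j, l⟩ h
    simp only [prismAdjClass, hdiv, hmod]
    rcases h with ⟨h1, h2⟩ | ⟨h1, h2, h3⟩
    · dsimp only at h1 h2
      subst h1
      cases e <;> simp [Fin.ext_iff, -Fin.val_eq_zero_iff] at h2 ⊢ <;> omega
    · dsimp only at h1 h2 h3
      subst h2
      simp [Fin.ext_iff, -Fin.val_eq_zero_iff] at h1 h3 ⊢
      simp [h1]
      omega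
  · rintro ⟨i, k⟩ ⟨j, l⟩ hne h
    simp only [prismNonClass, hdiv, hmod]
    by_cases hij : i = j
    · subst hij
      have hkl : k ≠ l := fun h => hne (h ▸ rfl)
      have h' := fun hh => h (Or.inl ⟨rfl, hh⟩)
      cases e <;> simp [Fin.ext_iff, -Fin.val_eq_zero_iff] at h' hkl ⊢ <;> omega
    · have h' : ¬ (k = l ∧ (k = 0 ∨ k = 1)) := fun hh => h (Or.inr ⟨hij, hh⟩)
      simp [Fin.ext_iff, -Fin.val_eq_zero_iff] at h' hij ⊢
      simp [hij]
      omega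

end Families

/-! ### Small graphs missing from the families -/

section Exclusions

/-- Two non-adjacent hubs completely joined to three complete graphs. -/
abbrev cliqueHub : (n : ℕ) → SimpleGraph (Bool ⊕ Fin 3 × Fin (n + 4)) :=
  hubFamily false (fun _ => false) (fun _ _ => true)

/-- Two adjacent hubs completely joined to three complete graphs. -/
abbrev cliqueAdjHub : (n : ℕ) → SimpleGraph (Bool ⊕ Fin 3 × Fin (n + 4)) :=
  hubFamily true (fun _ => false) (fun _ _ => true)

/-- Two non-adjacent hubs completely joined to three stars. -/
abbrev starHub : (n : ℕ) → SimpleGraph (Bool ⊕ Fin 3 × Fin (n + 4)) :=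
  hubFamily false (fun _ => true) (fun _ _ => true)

/-- Two non-adjacent hubs joined to the leaves of three stars. -/
abbrev leafHub : (n : ℕ) → SimpleGraph (Bool ⊕ Fin 3 × Fin (n + 4)) :=
  hubFamily false (fun _ => true) (fun _ z => !z)

/-- Two non-adjacent hubs completely joined to two complete graphs and joined to the leaves of a
star. -/
abbrev mixedHub : (n : ℕ) → SimpleGraph (Bool ⊕ Fin 3 × Fin (n + 4)) :=
  hubFamily false (fun i => i == 2) (fun i z => i != 2 || !z)

/-- The claw with one edge subdivided twice. -/
def longClaw : SimpleGraph (Fin 6) :=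
  SimpleGraph.fromEdgeSet {s(0, 1), s(0, 2), s(0, 3), s(3, 4), s(4, 5)}

/-- Adjacency of consecutive numbers. -/
def consecutive (p q : ℕ) : Bool := p == q + 1

lemma consecutive_pathGraph {n : ℕ} (p q : Fin n) (h : q < p) :
    id p ≠ id q ∧ (consecutive p q = true ↔ (SimpleGraph.pathGraph n).Adj (id p) (id q)) := by
  refine ⟨h.ne', ?_⟩
  rw [SimpleGraph.pathGraph_adj]
  simp only [consecutive, beq_iff_eq, id]
  omega

lemma complete_top {n : ℕ} (p q : Fin n) (h : q < p) :
    id p ≠ id q ∧ ((fun _ _ => true : ℕ → ℕ → Bool) p q = true ↔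
      (⊤ : SimpleGraph (Fin n)).Adj (id p) (id q)) := by
  simp [h.ne']

lemma pathGraph_four_not_cliqueHub (n : ℕ) : ¬ SimpleGraph.pathGraph 4 ⊴ cliqueHub n :=
  hubFamily_search _ _ _ n consecutive id consecutive_pathGraph (by decide +kernel)

lemma pathGraph_four_not_cliqueAdjHub (n : ℕ) : ¬ SimpleGraph.pathGraph 4 ⊴ cliqueAdjHub n :=
  hubFamily_search _ _ _ n consecutive id consecutive_pathGraph (by decide +kernel)

lemma pathGraph_four_not_starHub (n : ℕ) : ¬ SimpleGraph.pathGraph 4 ⊴ starHub n :=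
  hubFamily_search _ _ _ n consecutive id consecutive_pathGraph (by decide +kernel)

lemma pathGraph_five_not_mixedHub (n : ℕ) : ¬ SimpleGraph.pathGraph 5 ⊴ mixedHub n :=
  hubFamily_search _ _ _ n consecutive id consecutive_pathGraph (by decide +kernel)

lemma pathGraph_six_not_leafHub (n : ℕ) : ¬ SimpleGraph.pathGraph 6 ⊴ leafHub n :=
  hubFamily_search _ _ _ n consecutive id consecutive_pathGraph (by decide +kernel)

lemma pathGraph_seven_not_cliquePrism (n : ℕ) : ¬ SimpleGraph.pathGraph 7 ⊴ cliquePrism true n :=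
  cliquePrism_search _ n consecutive id consecutive_pathGraph (by decide +kernel)

/-- The family is bipartite: leaves against hubs and centres. -/
lemma top_three_not_leafHub (n : ℕ) : ¬ (⊤ : SimpleGraph (Fin 3)) ⊴ leafHub n :=
  hubFamily_search _ _ _ n (fun _ _ => true) id complete_top (by decide +kernel)

lemma top_four_not_starHub (n : ℕ) : ¬ (⊤ : SimpleGraph (Fin 4)) ⊴ starHub n :=
  hubFamily_search _ _ _ n (fun _ _ => true) id complete_top (by decide +kernel)

/-- Adjacent hubs dominate everything, so they lie on no induced 4-cycle, and without them only
disjoint cliques remain. -/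
lemma cycleGraph_four_not_cliqueAdjHub (n : ℕ) : ¬ SimpleGraph.cycleGraph 4 ⊴ cliqueAdjHub n :=
  hubFamily_search _ _ _ n (fun p q => p == q + 1 || p == q + 3) id
    (by decide) (by decide +kernel)

lemma longClaw_not_leafHub (n : ℕ) : ¬ longClaw ⊴ leafHub n :=
  hubFamily_search _ _ _ n
    (fun p q => [(1, 0), (2, 0), (3, 0), (4, 3), (5, 4)].contains (p, q)) id
    (by
      simp only [longClaw, SimpleGraph.fromEdgeSet_adj, Set.mem_insert_iff, Set.mem_singleton_iff]
      decide) (by decide +kernel)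

lemma wGraph_not_mixedHub (n : ℕ) : ¬ wGraph ⊴ mixedHub n :=
  hubFamily_search _ _ _ n
    (fun p q => q == 0 || (p % 2 == 0 && p == q + 1)) id
    (by
      simp only [wGraph, SimpleGraph.fromEdgeSet_adj, Set.mem_insert_iff, Set.mem_singleton_iff]
      decide) (by decide +kernel)

lemma claw_not_cliquePrism (e : Bool) (n : ℕ) : ¬ claw ⊴ cliquePrism e n := by
  refine cliquePrism_search _ n (fun _ q => q == 0) ![.inl 0, .inr 0, .inr 1, .inr 2]
    (by simp [Fin.forall_fin_succ]) ?_
  cases e <;> decide +kernel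

lemma net_three_one_zero_not_cliquePrism (n : ℕ) : ¬ net 3 1 0 ⊴ cliquePrism true n :=
  cliquePrism_search _ n
    (fun p q => [(1, 0), (2, 0), (2, 1), (3, 0), (4, 1), (5, 3), (6, 5)].contains (p, q))
    ![⟨0, 0⟩, ⟨1, 0⟩, ⟨2, 0⟩, ⟨0, 1⟩, ⟨1, 1⟩, ⟨0, 2⟩, ⟨0, 3⟩]
    (by
      simp only [net, SimpleGraph.fromRel_adj]
      decide) (by decide +kernel)

lemma net_two_one_one_not_cliquePrism (n : ℕ) : ¬ net 2 1 1 ⊴ cliquePrism true n :=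
  cliquePrism_search _ n
    (fun p q => [(1, 0), (2, 0), (2, 1), (3, 0), (4, 1), (5, 2), (6, 3)].contains (p, q))
    ![⟨0, 0⟩, ⟨1, 0⟩, ⟨2, 0⟩, ⟨0, 1⟩, ⟨1, 1⟩, ⟨2, 1⟩, ⟨0, 2⟩]
    (by
      simp only [net, SimpleGraph.fromRel_adj]
      decide) (by decide +kernel)

lemma net_two_two_zero_not_cliquePrism (n : ℕ) : ¬ net 2 2 0 ⊴ cliquePrism false n :=
  cliquePrism_search _ n
    (fun p q => [(1, 0), (2, 0), (2, 1), (3, 0), (4, 1), (5, 3), (6, 4)].contains (p, q))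
    ![⟨0, 0⟩, ⟨1, 0⟩, ⟨2, 0⟩, ⟨0, 1⟩, ⟨1, 1⟩, ⟨0, 2⟩, ⟨1, 2⟩]
    (by
      simp only [net, SimpleGraph.fromRel_adj]
      decide) (by decide +kernel)

end Exclusions

/-! ### Subgraphs of the long-path families -/

section Classification

lemma pathPrism_adj {n : ℕ} {x y : Fin 3 × Fin (n + 4)} : (pathPrism n).Adj x y ↔
    x.1 = y.1 ∧ (x.2.1 + 1 = y.2.1 ∨ y.2.1 + 1 = x.2.1) ∨
      x.1 ≠ y.1 ∧ x.2.1 = y.2.1 ∧ (x.2.1 = 0 ∨ x.2.1 = n + 3) := by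
  simp only [pathPrism, prismGraph, SimpleGraph.pathGraph_adj, Fin.ext_iff, Fin.val_zero,
    Fin.val_last]

/-- The neighbours of a vertex are covered by two cliques: two single path neighbours, or one path
neighbour and a triangle edge. So no three of them are pairwise nonadjacent. -/
lemma claw_not_pathPrism (n : ℕ) : ¬ claw ⊴ pathPrism n := by
  rintro ⟨φ⟩
  have hc : ∀ t, (pathPrism n).Adj (φ (.inl 0)) (φ (.inr t)) := fun t => by
    simp
  have hl : ∀ t t', ¬ (pathPrism n).Adj (φ (.inr t)) (φ (.inr t')) := fun t t' => by
    simp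
  have hne : ∀ t t', t ≠ t' → φ (.inr t) ≠ φ (.inr t') := fun t t' h h' =>
    h (Sum.inr.inj (φ.injective h'))
  have key : ∀ z x y : Fin 3 × Fin (n + 4), (pathPrism n).Adj z x → (pathPrism n).Adj z y →
      ¬ (pathPrism n).Adj x y → x ≠ y →
      (z.2.1 = x.2.1 + 1 ∧ y.2.1 = z.2.1 + 1 ∨ z.2.1 = y.2.1 + 1 ∧ x.2.1 = z.2.1 + 1) ∨
      (z.2.1 = 0 ∨ z.2.1 = n + 3) ∧ (x.2.1 = z.2.1 ∧ y.2.1 ≠ z.2.1 ∨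
        x.2.1 ≠ z.2.1 ∧ y.2.1 = z.2.1) := by
    intro z x y hzx hzy hxy hne
    simp only [pathPrism_adj, ne_eq, Prod.ext_iff, Fin.ext_iff] at *
    omega
  have h01 := key _ _ _ (hc 0) (hc 1) (hl 0 1) (hne 0 1 (by decide))
  have h02 := key _ _ _ (hc 0) (hc 2) (hl 0 2) (hne 0 2 (by decide))
  have h12 := key _ _ _ (hc 1) (hc 2) (hl 1 2) (hne 1 2 (by decide))
  omega

/-- A discrete intermediate value theorem: if the value `c` were skipped, being below `c` would be
constant along edges. -/
lemma exists_level_eq {V : Type} {H : SimpleGraph V} (hH : H.Preconnected) (f : V → ℤ)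
    (hf : ∀ x y, H.Adj x y → f x ≤ f y + 1) {a b : V} {c : ℤ} (ha : f a ≤ c) (hb : c ≤ f b) :
    ∃ z, f z = c := by
  by_contra! hcon
  have := pred_iff_of_preconnected hH (P := fun x => f x < c) (fun x y hxy => by
    have h1 := hf x y hxy
    have h2 := hf y x hxy.symm
    have h3 := hcon x
    have h4 := hcon y
    omega) a b
  have h1 := hcon a
  omega

lemma sub_lt_card_of_level {V : Type} [Fintype V] {H : SimpleGraph V} (hH : H.Preconnected)
    (f : V → ℤ) (hf : ∀ x y, H.Adj x y → f x ≤ f y + 1) (a b : V) :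
    f b - f a < Fintype.card V := by
  classical
  have hsub : Finset.Icc (f a) (f b) ⊆ Finset.univ.image f := by
    intro c hc
    rw [Finset.mem_Icc] at hc
    obtain ⟨z, hz⟩ := exists_level_eq hH f hf hc.1 hc.2
    simp [← hz]
  have := (Finset.card_le_card hsub).trans Finset.card_image_le
  rw [Int.card_Icc, Finset.card_univ] at this
  omega

/-- Levels have no gaps by connectedness, so an injective level function numbers the vertices by an
interval. -/
lemma exists_iso_pathGraph {V : Type} [Fintype V] {H : SimpleGraph V} (hH : H.Connected)
    (f : V → ℤ) (hinj : Function.Injective f)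
    (hf : ∀ x y, H.Adj x y ↔ f x = f y + 1 ∨ f y = f x + 1) :
    ∃ j, Nonempty (H ≃g SimpleGraph.pathGraph j) := by
  have hne := hH.nonempty
  obtain ⟨a, ha⟩ := Finite.exists_min f
  have hlip : ∀ x y, H.Adj x y → f x ≤ f y + 1 := fun x y h => by
    have := (hf x y).1 h
    omega
  have hlt : ∀ x, (f x - f a).toNat < Fintype.card V := fun x => by
    have h1 := sub_lt_card_of_level hH.preconnected f hlip a x
    have h2 := ha x
    omega
  have hbij : Function.Bijective fun x => (⟨(f x - f a).toNat, hlt x⟩ : Fin (Fintype.card V)) := by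
    rw [Fintype.bijective_iff_injective_and_card]
    refine ⟨fun x y hxy => hinj ?_, by simp⟩
    have h1 := ha x
    have h2 := ha y
    simp only [Fin.ext_iff] at hxy
    omega
  refine ⟨Fintype.card V, ⟨⟨Equiv.ofBijective _ hbij, ?_⟩⟩⟩
  intro x y
  rw [hf, SimpleGraph.pathGraph_adj]
  simp only [Equiv.ofBijective_apply]
  have h1 := ha x
  have h2 := ha y
  omega

/-- The map `ψ` need only behave well on the image of `φ`; it is usually not an embedding of all of
`F`. -/
lemma isIndContained_of_comp {U V W : Type*} {H : SimpleGraph U} {F : SimpleGraph V}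
    {F' : SimpleGraph W} (φ : H ↪g F) (ψ : V → W)
    (hψ : ∀ x y, φ x ≠ φ y → ψ (φ x) ≠ ψ (φ y) ∧
      (F'.Adj (ψ (φ x)) (ψ (φ y)) ↔ F.Adj (φ x) (φ y))) : H ⊴ F' := by
  refine ⟨⟨⟨fun x => ψ (φ x), fun x y h => ?_⟩, ?_⟩⟩
  · by_contra hne
    exact (hψ x y fun h => hne (φ.injective h)).1 h
  · intro x y
    by_cases hxy : x = y
    · simp [hxy]
    · exact (hψ x y fun h => hxy (φ.injective h)).2.trans φ.map_adj_iff

/-- The infinite spider with three legs. -/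
def spider : SimpleGraph (Option (Fin 3 × ℕ)) :=
  SimpleGraph.fromRel fun x y =>
    (x = none ∧ ∃ i, y = some (i, 0)) ∨ ∃ i k, x = some (i, k) ∧ y = some (i, k + 1)

/-- The triangle with infinite paths attached at its three vertices. -/
def infiniteNet : SimpleGraph (Fin 3 × ℕ) :=
  SimpleGraph.fromRel fun p q => (p.1 ≠ q.1 ∧ p.2 = 0 ∧ q.2 = 0) ∨ (p.1 = q.1 ∧ q.2 = p.2 + 1)

lemma spider_adj_some {i j : Fin 3} {k l : ℕ} :
    spider.Adj (some (i, k)) (some (j, l)) ↔ i = j ∧ (k = l + 1 ∨ l = k + 1) := by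
  simp only [spider, SimpleGraph.fromRel_adj, Option.some.injEq, Prod.mk.injEq, reduceCtorEq,
    false_and, false_or, ne_eq]
  constructor
  · rintro ⟨-, ⟨_, _, ⟨rfl, rfl⟩, rfl, rfl⟩ | ⟨_, _, ⟨rfl, rfl⟩, rfl, rfl⟩⟩ <;> simp
  · rintro ⟨rfl, rfl | rfl⟩
    · exact ⟨by simp, Or.inr ⟨_, _, ⟨rfl, rfl⟩, rfl, rfl⟩⟩
    · exact ⟨by simp, Or.inl ⟨_, _, ⟨rfl, rfl⟩, rfl, rfl⟩⟩

lemma spider_adj_none {j : Fin 3} {l : ℕ} : spider.Adj none (some (j, l)) ↔ l = 0 := by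
  simp [spider]

lemma spider_adj_none' {j : Fin 3} {l : ℕ} : spider.Adj (some (j, l)) none ↔ l = 0 := by
  simp [spider]

lemma infiniteNet_adj {p q : Fin 3 × ℕ} : infiniteNet.Adj p q ↔
    (p.1 ≠ q.1 ∧ p.2 = 0 ∧ q.2 = 0) ∨ (p.1 = q.1 ∧ (q.2 = p.2 + 1 ∨ p.2 = q.2 + 1)) := by
  simp only [infiniteNet, SimpleGraph.fromRel_adj, ne_eq, Prod.ext_iff]
  omega

/-- The hubs are farther apart than a connected graph on at most `n` vertices can stretch, so one
hub is missed; the theta graph without it is a spider. -/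
lemma isIndContained_spider {V : Type} [Fintype V] {H : SimpleGraph V} (hH : H.Preconnected)
    {n : ℕ} (hn : Fintype.card V ≤ n) (h : H ⊴ thetaFamily n) : H ⊴ spider := by
  obtain ⟨φ⟩ := h
  -- The distance from the hub `true`, which changes by at most one along an edge.
  let f : Bool ⊕ Fin 3 × Fin (n + 4) → ℤ
    | .inl s => if s then 0 else n + 5
    | .inr p => p.2.1 + 1
  have hf : ∀ x y, (thetaFamily n).Adj x y → f x ≤ f y + 1 := by
    rintro (s | ⟨i, k⟩) (s' | ⟨j, l⟩) h
    · exact absurd h.2 id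
    · have h' : l = if s then 0 else Fin.last (n + 3) := h
      cases s
      · simp only [Bool.false_eq_true, if_false, Fin.ext_iff, Fin.val_last] at h'
        simp [f, h']
        omega
      · simp [f]
        omega
    · have h' : k = if s' then 0 else Fin.last (n + 3) := h
      cases s'
      · simp only [Bool.false_eq_true, if_false, Fin.ext_iff, Fin.val_last] at h'
        simp [f, h']
      · simp only [if_true] at h'
        simp [f, h']
    · have h' := SimpleGraph.pathGraph_adj.1 h.2
      dsimp only at h'
      simp only [f]
      omega
  have hmiss : (∀ x, φ x ≠ .inl false) ∨ (∀ x, φ x ≠ .inl true) := by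
    by_contra! hcon
    obtain ⟨⟨a, ha⟩, ⟨b, hb⟩⟩ := hcon
    have := sub_lt_card_of_level hH (fun x => f (φ x))
      (fun x y h => hf _ _ (φ.map_adj_iff.2 h)) b a
    simp [ha, hb, f] at this
    omega
  rcases hmiss with hmiss | hmiss
  · refine isIndContained_of_comp φ (fun x => match x with
      | .inl _ => none
      | .inr p => some (p.1, p.2.1)) fun x y hne => ?_
    have hx := hmiss x
    have hy := hmiss y
    generalize φ x = x at *
    generalize φ y = y at *
    rcases x with (_ | _) | ⟨i, k⟩ <;> rcases y with (_ | _) | ⟨j, l⟩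
    all_goals first | exact absurd rfl hx | exact absurd rfl hy | skip
    · exact absurd rfl hne
    · refine ⟨by simp, spider_adj_none.trans (Iff.trans ?_ (Iff.rfl (a := l = 0)))⟩
      simp [Fin.ext_iff, -Fin.val_eq_zero_iff]
    · refine ⟨by simp, spider_adj_none'.trans (Iff.trans ?_ (Iff.rfl (a := k = 0)))⟩
      simp [Fin.ext_iff, -Fin.val_eq_zero_iff]
    · refine ⟨fun h => hne ?_, spider_adj_some.trans ?_⟩
      · simpa [Fin.ext_iff] using h
      · refine and_congr Iff.rfl ?_
        rw [SimpleGraph.pathGraph_adj]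
        omega
  -- The surviving hub is at the far end, so the legs are numbered backwards.
  · refine isIndContained_of_comp φ (fun x => match x with
      | .inl _ => none
      | .inr p => some (p.1, n + 3 - p.2.1)) fun x y hne => ?_
    have hx := hmiss x
    have hy := hmiss y
    generalize φ x = x at *
    generalize φ y = y at *
    rcases x with (_ | _) | ⟨i, k⟩ <;> rcases y with (_ | _) | ⟨j, l⟩
    all_goals first | exact absurd rfl hx | exact absurd rfl hy | skip
    · exact absurd rfl hne
    · refine ⟨by simp, spider_adj_none.trans (Iff.trans ?_ (Iff.rfl (a := l = Fin.last (n + 3))))⟩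
      simp only [Fin.ext_iff, Fin.val_last]
      omega
    · refine ⟨by simp, spider_adj_none'.trans (Iff.trans ?_ (Iff.rfl (a := k = Fin.last (n + 3))))⟩
      simp only [Fin.ext_iff, Fin.val_last]
      omega
    · refine ⟨fun h => hne ?_, spider_adj_some.trans ?_⟩
      · simp only [Option.some.injEq, Prod.mk.injEq] at h
        have : k = l := Fin.ext (by omega)
        rw [h.1, this]
      · refine and_congr Iff.rfl ?_
        rw [SimpleGraph.pathGraph_adj]
        omega

lemma isIndContained_infiniteNet {V : Type} [Fintype V] {H : SimpleGraph V} (hH : H.Preconnected)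
    {n : ℕ} (hn : Fintype.card V ≤ n) (h : H ⊴ pathPrism n) : H ⊴ infiniteNet := by
  obtain ⟨φ⟩ := h
  have hmiss : (∀ x, (φ x).2.1 ≠ n + 3) ∨ (∀ x, (φ x).2.1 ≠ 0) := by
    by_contra! hcon
    obtain ⟨⟨a, ha⟩, ⟨b, hb⟩⟩ := hcon
    have := sub_lt_card_of_level hH (fun x => ((φ x).2.1 : ℤ))
      (fun x y h => by
        have := pathPrism_adj.1 (φ.map_adj_iff.2 h)
        omega) b a
    simp only [ha, hb] at this
    omega
  rcases hmiss with hmiss | hmiss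
  · refine isIndContained_of_comp φ (fun p => (p.1, p.2.1)) fun x y hne => ?_
    have hx := hmiss x
    have hy := hmiss y
    simp only [infiniteNet_adj, pathPrism_adj, ne_eq, Prod.ext_iff, Fin.ext_iff] at hne ⊢
    omega
  · refine isIndContained_of_comp φ (fun p => (p.1, n + 3 - p.2.1)) fun x y hne => ?_
    have hx := hmiss x
    have hy := hmiss y
    simp only [infiniteNet_adj, pathPrism_adj, ne_eq, Prod.ext_iff, Fin.ext_iff] at hne ⊢
    omega

/-- A connected induced subgraph missing the centre stays on one leg, and one containing the centre
but no first vertex of a leg `i` avoids that leg. Either way it lies on a line. -/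
lemma spider_cases {V : Type} [Fintype V] {H : SimpleGraph V} (hH : H.Connected)
    (φ : H ↪g spider) : (∃ j, Nonempty (H ≃g SimpleGraph.pathGraph j)) ∨
      ((∃ x, φ x = none) ∧ ∀ i, ∃ x, φ x = some (i, 0)) := by
  classical
  by_contra! hcon
  obtain ⟨hnp, hcon⟩ := hcon
  have hpath : ∀ f : Option (Fin 3 × ℕ) → ℤ,
      ¬ ∀ x y, φ x ≠ φ y → f (φ x) ≠ f (φ y) ∧ (spider.Adj (φ x) (φ y) ↔
        f (φ x) = f (φ y) + 1 ∨ f (φ y) = f (φ x) + 1) := by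
    intro f hf
    obtain ⟨j, hj⟩ := exists_iso_pathGraph hH (fun x => f (φ x))
      (fun x y h => by
        by_contra hne
        exact (hf x y fun h => hne (φ.injective h)).1 h)
      (fun x y => by
        by_cases hxy : x = y
        · subst hxy
          simp
        · exact φ.map_adj_iff.symm.trans (hf x y fun h => hxy (φ.injective h)).2)
    exact (hnp j).false hj.some
  have harm : ∀ i, (∀ x, φ x = none → ∀ y, φ y ≠ some (i, 0)) → ∀ x y,
      (∃ k, φ x = some (i, k)) ↔ ∃ k, φ y = some (i, k) := by
    intro i hi
    refine pred_iff_of_preconnected hH.preconnected (P := fun x => ∃ k, φ x = some (i, k)) ?_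
    intro x y hxy
    have hadj := φ.map_adj_iff.2 hxy
    have hx := hi x
    have hy := hi y
    have hx := fun h => hx h y
    have hy := fun h => hy h x
    generalize φ x = x at *
    generalize φ y = y at *
    rcases x with _ | ⟨i', k⟩ <;> rcases y with _ | ⟨j', l⟩
    · simp
    · rw [spider_adj_none] at hadj
      simp_all
    · rw [spider_adj_none'] at hadj
      simp_all
    · rw [spider_adj_some] at hadj
      simp [hadj.1]
  by_cases h0 : ∃ x, φ x = none
  · obtain ⟨i, hi⟩ := hcon h0
    obtain ⟨x₀, hx₀⟩ := h0
    have hno : ∀ x k, φ x ≠ some (i, k) := by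
      intro x k hk
      obtain ⟨_, h⟩ := (harm i (fun _ _ y => hi y) x x₀).1 ⟨k, hk⟩
      simp [hx₀] at h
    -- The two remaining legs become the positive and the negative ray, with the centre at `0`.
    refine hpath (fun p => match p with
      | none => 0
      | some (j, k) => if j = i + 1 then k + 1 else -(k + 1)) fun x y hne => ?_
    have hx := hno x
    have hy := hno y
    generalize φ x = x at *
    generalize φ y = y at *
    rcases x with _ | ⟨i', k⟩ <;> rcases y with _ | ⟨j', l⟩
    · exact absurd rfl hne
    · rw [spider_adj_none]
      dsimp only
      split_ifs <;> omega
    · rw [spider_adj_none']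
      dsimp only
      split_ifs <;> omega
    · rw [spider_adj_some]
      have h1 : i' ≠ i := fun h => hx k (by rw [h])
      have h2 : j' ≠ i := fun h => hy l (by rw [h])
      have h3 : i' = j' → k ≠ l := fun h h' => hne (by rw [h, h'])
      have h4 : ∀ i i' j' : Fin 3, i' ≠ i → j' ≠ i → i' ≠ i + 1 → j' ≠ i + 1 → i' = j' := by decide
      have h4 := h4 i i' j' h1 h2
      dsimp only
      split_ifs with h5 h6 h6
      · subst h5
        simp only [h6, true_and]
        have := h3 h6.symm
        omega
      · have : i' ≠ j' := fun h => h6 (h ▸ h5)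
        simp only [this, false_and, false_iff]
        omega
      · have : i' ≠ j' := fun h => h5 (h ▸ h6)
        simp only [this, false_and, false_iff]
        omega
      · have := h4 h5 h6
        have := h3 this
        simp only [*, true_and]
        omega
  · push Not at h0
    obtain ⟨x₀⟩ := hH.nonempty
    obtain ⟨⟨i, k₀⟩, hik⟩ := Option.ne_none_iff_exists'.1 (h0 x₀)
    have hall := fun x => (harm i (fun x hx => absurd hx (h0 x)) x₀ x).1 ⟨k₀, hik⟩
    refine hpath (fun p => match p with
      | none => 0
      | some (_, k) => k) fun x y hne => ?_
    obtain ⟨k, hk⟩ := hall x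
    obtain ⟨l, hl⟩ := hall y
    rw [hk, hl] at hne ⊢
    rw [spider_adj_some]
    have : k ≠ l := fun h => hne (by rw [h])
    dsimp only
    omega

lemma spider_range_initial {V : Type} {H : SimpleGraph V} (hH : H.Connected)
    (φ : H ↪g spider) (h0 : ∃ x, φ x = none) {i : Fin 3} {k : ℕ}
    (h : ∃ x, φ x = some (i, k + 1)) : ∃ x, φ x = some (i, k) := by
  by_contra! hcon
  obtain ⟨x₀, hx₀⟩ := h0
  obtain ⟨x₁, hx₁⟩ := h
  obtain ⟨l, -, hl⟩ := (pred_iff_of_preconnected hH.preconnected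
    (P := fun x => ∃ l > k, φ x = some (i, l)) (fun x y hxy => by
      have hadj := φ.map_adj_iff.2 hxy
      have hx := hcon x
      have hy := hcon y
      generalize φ x = x at *
      generalize φ y = y at *
      rcases x with _ | ⟨i', m⟩ <;> rcases y with _ | ⟨j', l⟩
      · simp
      · rw [spider_adj_none] at hadj
        simp [hadj]
      · rw [spider_adj_none'] at hadj
        simp [hadj]
      · rw [spider_adj_some] at hadj
        obtain ⟨rfl, hadj⟩ := hadj
        have hx : i' = i → m ≠ k := fun h h' => hx (by rw [h, h'])
        have hy : i' = i → l ≠ k := fun h h' => hy (by rw [h, h'])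
        simp only [Option.some.injEq, Prod.mk.injEq]
        constructor
        · rintro ⟨_, h, h1, rfl⟩
          exact ⟨_, by have := hy h1; omega, h1, rfl⟩
        · rintro ⟨_, h, h1, rfl⟩
          exact ⟨_, by have := hx h1; omega, h1, rfl⟩) x₁ x₀).1 ⟨k + 1, by omega, hx₁⟩
  simp [hx₀] at hl

/-- If the triangle vertex `(i, 0)` is missed, connectedness keeps `H` on leg `i` or off it, and in
both cases on a line. -/
lemma infiniteNet_cases {V : Type} [Fintype V] {H : SimpleGraph V} (hH : H.Connected)
    (φ : H ↪g infiniteNet) : (∃ j, Nonempty (H ≃g SimpleGraph.pathGraph j)) ∨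
      ∀ i, ∃ x, φ x = (i, 0) := by
  classical
  by_contra! hcon
  obtain ⟨hnp, i, hi⟩ := hcon
  have hpath : ∀ f : Fin 3 × ℕ → ℤ,
      ¬ ∀ x y, φ x ≠ φ y → f (φ x) ≠ f (φ y) ∧ (infiniteNet.Adj (φ x) (φ y) ↔
        f (φ x) = f (φ y) + 1 ∨ f (φ y) = f (φ x) + 1) := by
    intro f hf
    obtain ⟨j, hj⟩ := exists_iso_pathGraph hH (fun x => f (φ x))
      (fun x y h => by
        by_contra hne
        exact (hf x y fun h => hne (φ.injective h)).1 h)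
      (fun x y => by
        by_cases hxy : x = y
        · subst hxy
          simp
        · exact φ.map_adj_iff.symm.trans (hf x y fun h => hxy (φ.injective h)).2)
    exact (hnp j).false hj.some
  have harm := pred_iff_of_preconnected hH.preconnected (P := fun x => (φ x).1 = i)
    (fun x y hxy => by
      have hadj := infiniteNet_adj.1 (φ.map_adj_iff.2 hxy)
      have hx := hi x
      have hy := hi y
      simp only [ne_eq, Prod.ext_iff] at hx hy
      constructor <;> intro h <;> omega)
  obtain ⟨x₀⟩ := hH.nonempty
  by_cases h0 : (φ x₀).1 = i
  · refine hpath (fun p => p.2) fun x y hne => ?_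
    have hx := (harm x₀ x).1 h0
    have hy := (harm x₀ y).1 h0
    simp only [infiniteNet_adj, ne_eq, Prod.ext_iff, hx, hy, not_true_eq_false, false_and,
      false_or, true_and] at hne ⊢
    omega
  -- Levels `0` and `-1` are the two ends of the remaining triangle edge.
  · refine hpath (fun p => if p.1 = i + 1 then p.2 else -1 - p.2) fun x y hne => ?_
    have hx : (φ x).1 ≠ i := fun h => h0 ((harm x x₀).1 h)
    have hy : (φ y).1 ≠ i := fun h => h0 ((harm y x₀).1 h)
    simp only [infiniteNet_adj, ne_eq, Prod.ext_iff] at hne ⊢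
    generalize φ x = x at *
    generalize φ y = y at *
    have h4 : ∀ i i' j' : Fin 3, i' ≠ i → j' ≠ i → i' ≠ i + 1 → j' ≠ i + 1 → i' = j' := by decide
    have h4 := h4 i x.1 y.1 hx hy
    split_ifs with h5 h6 h6
    · have : x.1 = y.1 := h5.trans h6.symm
      simp only [this, true_and, not_true_eq_false, false_and, false_or] at hne ⊢
      omega
    · have : x.1 ≠ y.1 := fun h => h6 (h ▸ h5)
      simp only [this, false_and, not_false_eq_true, true_and, or_false]
      omega
    · have : x.1 ≠ y.1 := fun h => h5 (h ▸ h6)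
      simp only [this, false_and, not_false_eq_true, true_and, or_false]
      omega
    · have := h4 h5 h6
      simp only [this, true_and, not_true_eq_false, false_and, false_or] at hne ⊢
      omega

/-- A gap at `(i, k)` would separate the vertices beyond it from the vertex at `(i + 1, 0)`. -/
lemma infiniteNet_range_initial {V : Type} {H : SimpleGraph V} (hH : H.Connected)
    (φ : H ↪g infiniteNet) (h0 : ∀ i, ∃ x, φ x = (i, 0)) {i : Fin 3} {k : ℕ}
    (h : ∃ x, φ x = (i, k + 1)) : ∃ x, φ x = (i, k) := by
  by_contra! hcon
  obtain ⟨x₀, hx₀⟩ := h0 (i + 1)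
  obtain ⟨x₁, hx₁⟩ := h
  have := (pred_iff_of_preconnected hH.preconnected
    (P := fun x => (φ x).1 = i ∧ k < (φ x).2) (fun x y hxy => by
      have hadj := infiniteNet_adj.1 (φ.map_adj_iff.2 hxy)
      have hx := hcon x
      have hy := hcon y
      simp only [ne_eq, Prod.ext_iff] at hx hy
      omega) x₁ x₀).1 (by simp [hx₁])
  simp [hx₀] at this

end Classification

/-! ### Finite nets with sorted legs -/

section Nets

lemma net_adj_iff {a b c : ℕ} {p q : Σ i : Fin 3, Fin (![a, b, c] i + 1)} :
    (net a b c).Adj p q ↔ (p.1 ≠ q.1 ∧ (p.2 : ℕ) = 0 ∧ (q.2 : ℕ) = 0) ∨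
      (p.1 = q.1 ∧ ((q.2 : ℕ) = p.2 + 1 ∨ (p.2 : ℕ) = q.2 + 1)) := by
  by_cases h : p = q
  · subst h
    simp
  · simp only [net, SimpleGraph.fromRel_adj, ne_eq, h, not_false_eq_true, true_and]
    omega

lemma isIndContained_of_injective {V W : Type*} {H : SimpleGraph V} {F : SimpleGraph W}
    (f : V → W) (hf : Function.Injective f) (h : ∀ x y, F.Adj (f x) (f y) ↔ H.Adj x y) : H ⊴ F :=
  ⟨⟨⟨f, hf⟩, h _ _⟩⟩

lemma net_isIndContained_of_range {V : Type} {H : SimpleGraph V} (φ : H ↪g infiniteNet)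
    (σ : Equiv.Perm (Fin 3)) {a b c : ℕ}
    (hr : ∀ i, ∀ k ≤ ![a, b, c] i, ∃ x, φ x = (σ i, k)) : net a b c ⊴ H := by
  have : ∀ p : Σ i : Fin 3, Fin (![a, b, c] i + 1), ∃ x, φ x = (σ p.1, (p.2 : ℕ)) :=
    fun p => hr p.1 p.2 (Nat.lt_succ_iff.1 p.2.2)
  choose g hg using this
  refine isIndContained_of_injective g (fun p q h => ?_) ?_
  · have h := (hg p).symm.trans ((congrArg φ h).trans (hg q))
    rcases p with ⟨i, k⟩
    rcases q with ⟨j, l⟩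
    simp only [Prod.mk.injEq, EmbeddingLike.apply_eq_iff_eq] at h
    obtain ⟨rfl, h⟩ := h
    rw [Fin.ext h]
  · intro p q
    refine φ.map_adj_iff.symm.trans ?_
    simp only [hg, infiniteNet_adj, net_adj_iff, ne_eq,
      EmbeddingLike.apply_eq_iff_eq]

lemma isIndContained_net_of_bound {V : Type} {H : SimpleGraph V} (φ : H ↪g infiniteNet)
    (σ : Equiv.Perm (Fin 3)) {a b c : ℕ}
    (hb : ∀ x, (φ x).2 ≤ ![a, b, c] (σ.symm (φ x).1)) : H ⊴ net a b c := by
  refine isIndContained_of_injective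
    (fun x => ⟨σ.symm (φ x).1, ⟨(φ x).2, Nat.lt_succ_iff.2 (hb x)⟩⟩) (fun x y h => ?_) ?_
  · have h1 : σ.symm (φ x).1 = σ.symm (φ y).1 := (Sigma.ext_iff.1 h).1
    have h2 := congrArg (fun p : Σ i : Fin 3, Fin (![a, b, c] i + 1) => (p.2 : ℕ)) h
    exact φ.injective (Prod.ext (σ.symm.injective h1) h2)
  · intro x y
    refine Iff.trans ?_ φ.map_adj_iff
    simp only [infiniteNet_adj, net_adj_iff, ne_eq,
      EmbeddingLike.apply_eq_iff_eq]

/-- The image is an initial segment of each leg, so `H` is itself a net. Both comparisons with other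
nets are recorded instead of an isomorphism. -/
lemma exists_sorted_net {V : Type} [Fintype V] {H : SimpleGraph V} (hH : H.Connected)
    (φ : H ↪g infiniteNet) (h0 : ∀ i, ∃ x, φ x = (i, 0)) :
    ∃ m₀ m₁ m₂ : ℕ, m₁ ≤ m₀ ∧ m₂ ≤ m₁ ∧
      (∀ a b c, a ≤ m₀ → b ≤ m₁ → c ≤ m₂ → net a b c ⊴ H) ∧
      ∀ a b c, m₀ ≤ a → m₁ ≤ b → m₂ ≤ c → H ⊴ net a b c := by
  classical
  have hmax : ∀ i, ∃ l, (∃ x, φ x = (i, l)) ∧ ∀ x, (φ x).1 = i → (φ x).2 ≤ l := by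
    intro i
    obtain ⟨x₀, hx₀⟩ := h0 i
    obtain ⟨x, hx, hmax⟩ := (Finset.univ.filter fun x => (φ x).1 = i).exists_max_image
      (fun x => (φ x).2) ⟨x₀, by simp [hx₀]⟩
    simp only [Finset.mem_filter, Finset.mem_univ, true_and] at hx hmax
    exact ⟨(φ x).2, ⟨x, Prod.ext hx rfl⟩, hmax⟩
  choose l hl hlmax using hmax
  have hrange : ∀ i, ∀ k ≤ l i, ∃ x, φ x = (i, k) := by
    intro i k hk
    induction hk using Nat.decreasingInduction with
    | self => exact hl i
    | of_succ k _ ih => exact infiniteNet_range_initial hH φ h0 ih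
  -- The sign makes the increasing sort list the legs by decreasing length.
  have hmono := Tuple.monotone_sort fun i => -(l i : ℤ)
  set σ := Tuple.sort fun i => -(l i : ℤ)
  have h01 := hmono (show (0 : Fin 3) ≤ 1 by decide)
  have h12 := hmono (show (1 : Fin 3) ≤ 2 by decide)
  simp only [Function.comp_apply, neg_le_neg_iff, Nat.cast_le] at h01 h12
  refine ⟨l (σ 0), l (σ 1), l (σ 2), h01, h12, fun a b c ha hb hc => ?_, fun a b c ha hb hc => ?_⟩
  · refine net_isIndContained_of_range φ σ fun i k hk => hrange _ _ (hk.trans ?_)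
    fin_cases i <;> simpa
  · refine isIndContained_net_of_bound φ σ fun x => ?_
    have h := hlmax _ x rfl
    generalize hi : σ.symm (φ x).1 = i
    rw [Equiv.symm_apply_eq] at hi
    rw [hi] at h
    refine h.trans ?_
    fin_cases i <;> simpa

end Nets

/-! ### Concrete small graphs -/

section SmallGraphs

lemma pathGraph_mono {m n : ℕ} (h : m ≤ n) :
    SimpleGraph.pathGraph m ⊴ SimpleGraph.pathGraph n := by
  refine ⟨⟨⟨Fin.castLE h, Fin.castLE_injective h⟩, ?_⟩⟩
  intro x y
  simp [SimpleGraph.pathGraph_adj]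

lemma top_isIndContained_of_adj {V : Type} {H : SimpleGraph V} {n : ℕ} (f : Fin n → V)
    (hf : ∀ p q, p < q → H.Adj (f p) (f q)) : (⊤ : SimpleGraph (Fin n)) ⊴ H := by
  have hadj : ∀ p q, p ≠ q → H.Adj (f p) (f q) := by
    intro p q h
    rcases lt_or_gt_of_ne h with h | h
    exacts [hf p q h, (hf q p h).symm]
  refine ⟨⟨⟨f, fun p q h => ?_⟩, ?_⟩⟩
  · by_contra hne
    exact (hadj p q hne).ne h
  · intro p q
    exact ⟨fun h hpq => h.ne (congrArg f hpq), fun h => hadj p q h⟩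

lemma wGraph_adj {x y : Fin 7} :
    wGraph.Adj x y ↔ x ≠ y ∧ (x = 0 ∨ y = 0 ∨ (x.1 - 1) / 2 = (y.1 - 1) / 2) := by
  simp only [wGraph, SimpleGraph.fromEdgeSet_adj, Set.mem_insert_iff, Set.mem_singleton_iff]
  revert x y
  decide

lemma wStar_adj {x y : Fin 6} :
    wStar.Adj x y ↔ x ≠ y ∧ (x = 0 ∨ y = 0 ∨ (x.1 - 1) / 2 = (y.1 - 1) / 2) := by
  simp only [wStar, SimpleGraph.fromEdgeSet_adj, Set.mem_insert_iff, Set.mem_singleton_iff]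
  revert x y
  decide

lemma k4Minus_adj {x y : Fin 4} :
    k4Minus.Adj x y ↔ x ≠ y ∧ (x.1 < 2 ∨ y.1 < 2) := by
  simp only [k4Minus, SimpleGraph.deleteEdges_adj, SimpleGraph.top_adj, Set.mem_singleton_iff]
  revert x y
  decide

lemma clawStar_adj {x y : Fin 7} : clawStar.Adj x y ↔
    (x = 0 ∧ 1 ≤ y.1 ∧ y.1 ≤ 3) ∨ (y = 0 ∧ 1 ≤ x.1 ∧ x.1 ≤ 3) ∨
      (x ≠ 0 ∧ y.1 = x.1 + 3) ∨ (y ≠ 0 ∧ x.1 = y.1 + 3) := by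
  simp only [clawStar, SimpleGraph.fromEdgeSet_adj, Set.mem_insert_iff, Set.mem_singleton_iff]
  revert x y
  decide

lemma pathGraph_three_claw : SimpleGraph.pathGraph 3 ⊴ claw := by
  refine isIndContained_of_injective ![.inr 0, .inl 0, .inr 1] (by decide) ?_
  simp [SimpleGraph.pathGraph_adj, Fin.forall_fin_succ]

lemma pathGraph_four_net_two_zero_zero : SimpleGraph.pathGraph 4 ⊴ net 2 0 0 := by
  refine isIndContained_of_injective ![⟨1, 0⟩, ⟨0, 0⟩, ⟨0, 1⟩, ⟨0, 2⟩] (by decide) ?_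
  simp only [SimpleGraph.pathGraph_adj, net_adj_iff]
  decide

lemma pathGraph_four_net_one_one_zero : SimpleGraph.pathGraph 4 ⊴ net 1 1 0 := by
  refine isIndContained_of_injective ![⟨0, 1⟩, ⟨0, 0⟩, ⟨1, 0⟩, ⟨1, 1⟩] (by decide) ?_
  simp only [SimpleGraph.pathGraph_adj, net_adj_iff]
  decide

lemma pathGraph_six_net : SimpleGraph.pathGraph 6 ⊴ net 4 0 0 := by
  refine isIndContained_of_injective ![⟨1, 0⟩, ⟨0, 0⟩, ⟨0, 1⟩, ⟨0, 2⟩, ⟨0, 3⟩, ⟨0, 4⟩]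
    (by decide) ?_
  simp only [SimpleGraph.pathGraph_adj, net_adj_iff]
  decide

lemma pathGraph_seven_net : SimpleGraph.pathGraph 7 ⊴ net 5 0 0 := by
  refine isIndContained_of_injective ![⟨1, 0⟩, ⟨0, 0⟩, ⟨0, 1⟩, ⟨0, 2⟩, ⟨0, 3⟩, ⟨0, 4⟩, ⟨0, 5⟩]
    (by decide) ?_
  simp only [SimpleGraph.pathGraph_adj, net_adj_iff]
  decide

lemma top_three_net : (⊤ : SimpleGraph (Fin 3)) ⊴ net 0 0 0 := by
  refine top_isIndContained_of_adj ![⟨0, 0⟩, ⟨1, 0⟩, ⟨2, 0⟩] ?_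
  simp only [net_adj_iff]
  decide

/-- Deleting a vertex of degree `2` from `wGraph` leaves `wStar`. -/
lemma exists_map_wStar (z : Fin 7) (hz : z ≠ 0) : ∃ f : Fin 7 → Fin 6, ∀ x y, x ≠ z → y ≠ z →
    x ≠ y → f x ≠ f y ∧ (wStar.Adj (f x) (f y) ↔ wGraph.Adj x y) := by
  simp only [wStar_adj, wGraph_adj]
  fin_cases z
  · exact absurd rfl hz
  -- The partner of the deleted vertex becomes the pendant vertex `5`; the value at the deleted
  -- vertex itself is a dummy.
  · exact ⟨![0, 0, 5, 1, 2, 3, 4], by decide⟩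
  · exact ⟨![0, 5, 0, 1, 2, 3, 4], by decide⟩
  · exact ⟨![0, 1, 2, 0, 5, 3, 4], by decide⟩
  · exact ⟨![0, 1, 2, 5, 0, 3, 4], by decide⟩
  · exact ⟨![0, 1, 2, 3, 4, 0, 5], by decide⟩
  · exact ⟨![0, 1, 2, 3, 4, 5, 0], by decide⟩

/-- Some vertex of `W` is missed. If it is the centre, only three disjoint edges remain and a
connected graph misses some other vertex as well. -/
lemma isIndContained_wStar {V : Type} {H : SimpleGraph V} (hH : H.Connected)
    (h : H ⊴ wGraph) (hW : ¬ wGraph ⊴ H) : H ⊴ wStar := by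
  obtain ⟨φ⟩ := h
  have hmiss : ∃ z, ∀ x, φ x ≠ z := by
    by_contra! hsurj
    exact hW ⟨(RelIso.ofSurjective φ hsurj).symm.toRelEmbedding⟩
  have hmiss' : ∃ z, z ≠ 0 ∧ ∀ x, φ x ≠ z := by
    obtain ⟨z, hz⟩ := hmiss
    by_cases h0 : z = 0
    · subst h0
      by_contra! hcon
      obtain ⟨a, ha⟩ := hcon 1 (by decide)
      obtain ⟨b, hb⟩ := hcon 3 (by decide)
      have hpair : ∀ p q : Fin 7, p ≠ 0 → q ≠ 0 → wGraph.Adj p q →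
          ((p = 1 ∨ p = 2) ↔ (q = 1 ∨ q = 2)) := by
        intro p q hp hq h
        rw [wGraph_adj] at h
        simp only [Fin.ext_iff, ne_eq] at *
        simp
        omega
      have := pred_iff_of_preconnected hH.preconnected (P := fun x => φ x = 1 ∨ φ x = 2)
        (fun x y hxy => hpair _ _ (hz x) (hz y) (φ.map_adj_iff.2 hxy)) a b
      simp [ha, hb] at this
    · exact ⟨z, h0, hz⟩
  obtain ⟨z, hz0, hz⟩ := hmiss'
  obtain ⟨f, hf⟩ := exists_map_wStar z hz0
  exact isIndContained_of_comp φ f fun x y hne => hf _ _ (hz x) (hz y) hne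

end SmallGraphs

/-! ### Small spiders -/

section Spiders

variable {V : Type} {H : SimpleGraph V} (φ : H ↪g spider)

lemma claw_isIndContained_of_spider (h0 : ∃ x, φ x = none) (h1 : ∀ i, ∃ x, φ x = some (i, 0)) :
    claw ⊴ H := by
  obtain ⟨c, hc⟩ := h0
  choose g hg using h1
  refine isIndContained_of_injective (Sum.elim (fun _ => c) g) ?_ ?_
  · rintro (s | s) (t | t) h
    · rw [Subsingleton.elim s t]
    · have := congrArg φ h
      simp [hc, hg] at this
    · have := congrArg φ h
      simp [hc, hg] at this
    · have := congrArg φ h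
      simp only [Sum.elim_inr, hg] at this
      simpa using this
  · rintro (s | s) (t | t)
    · simp
    · rw [← φ.map_adj_iff]
      simp [hc, hg, spider_adj_none]
    · rw [← φ.map_adj_iff]
      simp [hc, hg, spider_adj_none']
    · rw [← φ.map_adj_iff]
      simp [hg, spider_adj_some]

/-- A second vertex on a leg would give an induced `P₄` through the centre into another leg. -/
lemma isIndContained_claw_of_spider (hH : H.Connected) (h0 : ∃ x, φ x = none)
    (h1 : ∀ i, ∃ x, φ x = some (i, 0)) (hP : ¬ SimpleGraph.pathGraph 4 ⊴ H) : H ⊴ claw := by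
  have hno : ∀ i, ¬ ∃ x, φ x = some (i, 1) := by
    rintro i ⟨x, hx⟩
    obtain ⟨c, hc⟩ := h0
    obtain ⟨y, hy⟩ := h1 i
    obtain ⟨z, hz⟩ := h1 (i + 1)
    have hi : ¬ i = i + 1 := by omega
    refine hP (isIndContained_of_injective ![x, y, c, z] ?_ ?_)
    · refine Function.Injective.of_comp (f := φ) ?_
      intro p q
      fin_cases p <;> fin_cases q <;> simp [hx, hy, hc, hz]
    · intro p q
      rw [← φ.map_adj_iff]
      fin_cases p <;> fin_cases q <;>
        simp [hx, hy, hc, hz, spider_adj_some, spider_adj_none, spider_adj_none',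
          SimpleGraph.pathGraph_adj, hi, Ne.symm hi]
  have hlow : ∀ x i k, φ x = some (i, k) → k = 0 := by
    intro x i k hx
    by_contra hk
    have key : ∀ k, (∃ x, φ x = some (i, k + 1)) → False := by
      intro k
      induction k with
      | zero => exact hno i
      | succ k ih => exact fun h => ih (spider_range_initial hH φ h0 h)
    exact key (k - 1) ⟨x, by rw [hx, Nat.sub_add_cancel (Nat.pos_of_ne_zero hk)]⟩
  refine isIndContained_of_comp φ (fun p => match p with
    | none => .inl 0
    | some (i, _) => .inr i) fun x y hne => ?_
  have hx := hlow x
  have hy := hlow y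
  generalize φ x = x at *
  generalize φ y = y at *
  rcases x with _ | ⟨i, k⟩ <;> rcases y with _ | ⟨j, l⟩
  · exact absurd rfl hne
  · simp [spider_adj_none, hy j l rfl]
  · simp [spider_adj_none', hx i k rfl]
  · have hk := hx i k rfl
    have hl := hy j l rfl
    subst hk hl
    simpa [spider_adj_some] using hne

/-- A third vertex on a leg would, with the first vertices of the other two legs, give `longClaw`.
-/
lemma isIndContained_clawStar_of_spider (hH : H.Connected) (h0 : ∃ x, φ x = none)
    (h1 : ∀ i, ∃ x, φ x = some (i, 0)) (hP : ¬ longClaw ⊴ H) : H ⊴ clawStar := by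
  have hno : ∀ i, ¬ ∃ x, φ x = some (i, 2) := by
    intro i h
    obtain ⟨x', hx'⟩ := spider_range_initial hH φ h0 h
    obtain ⟨x, hx⟩ := h
    obtain ⟨c, hc⟩ := h0
    obtain ⟨y, hy⟩ := h1 i
    obtain ⟨z, hz⟩ := h1 (i + 1)
    obtain ⟨w, hw⟩ := h1 (i + 2)
    have hi : ¬ i = i + 1 := by omega
    have hi' : ¬ i = i + 2 := by omega
    have hi'' : ¬ i + 1 = i + 2 := by omega
    refine hP (isIndContained_of_injective ![c, z, w, y, x', x] ?_ ?_)
    · refine Function.Injective.of_comp (f := φ) ?_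
      intro p q
      fin_cases p <;> fin_cases q <;>
        simp [hx, hx', hy, hc, hz, hw, hi, hi', hi'', Ne.symm hi, Ne.symm hi', Ne.symm hi'']
    · intro p q
      rw [← φ.map_adj_iff]
      simp only [longClaw, SimpleGraph.fromEdgeSet_adj, Set.mem_insert_iff,
        Set.mem_singleton_iff]
      fin_cases p <;> fin_cases q <;>
        simp [hx, hx', hy, hc, hz, hw, spider_adj_some, spider_adj_none, spider_adj_none',
          hi, hi', hi'', Ne.symm hi, Ne.symm hi', Ne.symm hi'']
  have hlow : ∀ x i k, φ x = some (i, k) → k ≤ 1 := by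
    intro x i k hx
    by_contra hk
    have key : ∀ k, (∃ x, φ x = some (i, k + 2)) → False := by
      intro k
      induction k with
      | zero => exact hno i
      | succ k ih => exact fun h => ih (spider_range_initial hH φ h0 h)
    exact key (k - 2) ⟨x, by rw [hx, Nat.sub_add_cancel (by omega)]⟩
  refine isIndContained_of_comp φ (fun p => match p with
    | none => 0
    -- The reduction modulo `7` only supplies the bound; for `k ≤ 1` it changes nothing.
    | some (i, k) => ⟨(1 + i.1 + 3 * k) % 7, Nat.mod_lt _ (by norm_num)⟩) fun x y hne => ?_
  have hx := hlow x
  have hy := hlow y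
  generalize φ x = x at *
  generalize φ y = y at *
  rcases x with _ | ⟨i, k⟩ <;> rcases y with _ | ⟨j, l⟩
  · exact absurd rfl hne
  · have hl := hy j l rfl
    simp only [spider_adj_none, clawStar_adj, ne_eq, Fin.ext_iff, Fin.val_zero, true_and,
      not_true_eq_false, false_and, false_or, Nat.mod_eq_of_lt (show 1 + j.1 + 3 * l < 7 by omega)]
    omega
  · have hk := hx i k rfl
    simp only [spider_adj_none', clawStar_adj, ne_eq, Fin.ext_iff, Fin.val_zero, true_and,
      not_true_eq_false, false_and, or_false, Nat.mod_eq_of_lt (show 1 + i.1 + 3 * k < 7 by omega)]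
    omega
  · have hk := hx i k rfl
    have hl := hy j l rfl
    simp only [ne_eq, Option.some.injEq, Prod.mk.injEq, Fin.ext_iff] at hne
    simp only [spider_adj_some, clawStar_adj, ne_eq, Fin.ext_iff, Fin.val_zero,
      Nat.mod_eq_of_lt (show 1 + j.1 + 3 * l < 7 by omega),
      Nat.mod_eq_of_lt (show 1 + i.1 + 3 * k < 7 by omega)]
    omega

end Spiders

/-! ### Subgraphs of two hubs joined to three cliques -/

section CliqueHub

variable {V : Type} {H : SimpleGraph V}

/-- Every vertex other than `c` is adjacent to `c`, and two such vertices are adjacent if and only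
if they have the same colour. -/
def IsColouredCone (H : SimpleGraph V) (c : V) (col : V → Fin 3) : Prop :=
  (∀ x, x ≠ c → H.Adj c x) ∧ ∀ x y, x ≠ c → y ≠ c → x ≠ y → (H.Adj x y ↔ col x = col y)

/-- The vertices `u` and `v` are distinct and non-adjacent, and all other pairs are adjacent. -/
def IsCompleteMinusEdge (H : SimpleGraph V) (u v : V) : Prop :=
  u ≠ v ∧ ¬ H.Adj u v ∧ ∀ x, x ≠ u → x ≠ v → H.Adj u x ∧ H.Adj v x ∧
    ∀ y, y ≠ u → y ≠ v → x ≠ y → H.Adj x y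

lemma cycleGraph_four_isIndContained {V : Type*} {H : SimpleGraph V} {u v x y : V}
    (huv : ¬ H.Adj u v) (hxy : ¬ H.Adj x y) (hne : u ≠ v) (hne' : x ≠ y) (hux : H.Adj u x)
    (huy : H.Adj u y) (hvx : H.Adj v x) (hvy : H.Adj v y) : SimpleGraph.cycleGraph 4 ⊴ H := by
  have hvu : ¬ H.Adj v u := fun h => huv h.symm
  have hyx : ¬ H.Adj y x := fun h => hxy h.symm
  refine isIndContained_of_injective ![u, x, v, y] ?_ ?_
  · intro p q
    have := hux.ne
    have := huy.ne
    have := hvx.ne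
    have := hvy.ne
    fin_cases p <;> fin_cases q <;> simp_all [eq_comm]
  · intro p q
    fin_cases p <;> fin_cases q <;>
      simp [SimpleGraph.cycleGraph_adj, huv, hvu, hxy, hyx, hux, huy, hvx, hvy, hux.symm,
        huy.symm, hvx.symm, hvy.symm] <;> decide

/-- The cases are the number of hubs used: with none, connectedness confines `H` to one clique; one
hub is the apex of a cone; with both, two nonadjacent other vertices would close an induced 4-cycle.
-/
lemma cliqueHub_cases (hH : H.Connected) {n : ℕ} (h : H ⊴ cliqueHub n)
    (hC : ¬ SimpleGraph.cycleGraph 4 ⊴ H) :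
    (∀ x y, x ≠ y → H.Adj x y) ∨ (∃ c col, IsColouredCone H c col) ∨
      ∃ u v, IsCompleteMinusEdge H u v := by
  obtain ⟨φ⟩ := h
  have hhh : ∀ s t, ¬ (cliqueHub n).Adj (.inl s) (.inl t) := by
    rintro s t ⟨-, h⟩
    exact Bool.false_ne_true h
  have hhc : ∀ s p, (cliqueHub n).Adj (.inl s) (.inr p) := fun _ _ => rfl
  have hcc : ∀ p q, (cliqueHub n).Adj (.inr p) (.inr q) ↔ p.1 = q.1 ∧ p ≠ q := by
    rintro ⟨i, k⟩ ⟨j, l⟩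
    refine and_congr_right fun h => ?_
    dsimp only at h
    subst h
    simp
  have hadj : ∀ x y, H.Adj x y ↔ (cliqueHub n).Adj (φ x) (φ y) := fun x y => φ.map_adj_iff.symm
  have hinj : ∀ x y, x ≠ y → φ x ≠ φ y := fun x y h h' => h (φ.injective h')
  by_cases hu : ∃ u, φ u = .inl true
  · obtain ⟨u, hu⟩ := hu
    by_cases hv : ∃ v, φ v = .inl false
    · obtain ⟨v, hv⟩ := hv
      have hrest : ∀ x, x ≠ u → x ≠ v → ∃ p, φ x = .inr p := by
        intro x hxu hxv
        rcases hx : φ x with (_ | _) | p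
        · exact absurd (φ.injective (hx.trans hv.symm)) hxv
        · exact absurd (φ.injective (hx.trans hu.symm)) hxu
        · exact ⟨p, rfl⟩
      have huv : ¬ H.Adj u v := by
        rw [hadj, hu, hv]
        exact hhh _ _
      have hne : u ≠ v := by
        rintro rfl
        rw [hu] at hv
        simp at hv
      have huv' : ∀ x, x ≠ u → x ≠ v → H.Adj u x ∧ H.Adj v x := by
        intro x hxu hxv
        obtain ⟨p, hp⟩ := hrest x hxu hxv
        rw [hadj, hadj, hu, hv, hp]
        exact ⟨hhc _ _, hhc _ _⟩
      refine Or.inr (Or.inr ⟨u, v, hne, huv, fun x hxu hxv =>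
        ⟨(huv' x hxu hxv).1, (huv' x hxu hxv).2, fun y hyu hyv hxy => ?_⟩⟩)
      by_contra hcon
      exact hC (cycleGraph_four_isIndContained huv hcon hne hxy (huv' x hxu hxv).1
        (huv' y hyu hyv).1 (huv' x hxu hxv).2 (huv' y hyu hyv).2)
    · refine Or.inr (Or.inl ⟨u, fun x => Sum.elim (fun _ => 0) (fun p => p.1) (φ x), ?_⟩)
      have hrest : ∀ x, x ≠ u → ∃ p, φ x = .inr p := by
        intro x hxu
        rcases hx : φ x with (_ | _) | p
        · exact absurd ⟨x, hx⟩ hv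
        · exact absurd (φ.injective (hx.trans hu.symm)) hxu
        · exact ⟨p, rfl⟩
      refine ⟨fun x hx => ?_, fun x y hx hy hxy => ?_⟩
      · obtain ⟨p, hp⟩ := hrest x hx
        rw [hadj, hu, hp]
        exact hhc _ _
      · obtain ⟨p, hp⟩ := hrest x hx
        obtain ⟨q, hq⟩ := hrest y hy
        have := hinj x y hxy
        rw [hp, hq] at this
        rw [hadj, hp, hq, hcc]
        simp only [hp, hq, Sum.elim_inr]
        exact and_iff_left fun h => this (congrArg _ h)
  · by_cases hv : ∃ v, φ v = .inl false
    · obtain ⟨v, hv⟩ := hv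
      refine Or.inr (Or.inl ⟨v, fun x => Sum.elim (fun _ => 0) (fun p => p.1) (φ x), ?_⟩)
      have hrest : ∀ x, x ≠ v → ∃ p, φ x = .inr p := by
        intro x hxv
        rcases hx : φ x with (_ | _) | p
        · exact absurd (φ.injective (hx.trans hv.symm)) hxv
        · exact absurd ⟨x, hx⟩ hu
        · exact ⟨p, rfl⟩
      refine ⟨fun x hx => ?_, fun x y hx hy hxy => ?_⟩
      · obtain ⟨p, hp⟩ := hrest x hx
        rw [hadj, hv, hp]
        exact hhc _ _
      · obtain ⟨p, hp⟩ := hrest x hx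
        obtain ⟨q, hq⟩ := hrest y hy
        have := hinj x y hxy
        rw [hp, hq] at this
        rw [hadj, hp, hq, hcc]
        simp only [hp, hq, Sum.elim_inr]
        exact and_iff_left fun h => this (congrArg _ h)
    · left
      have hrest : ∀ x, ∃ p, φ x = .inr p := by
        intro x
        rcases hx : φ x with (_ | _) | p
        · exact absurd ⟨x, hx⟩ hv
        · exact absurd ⟨x, hx⟩ hu
        · exact ⟨p, rfl⟩
      choose g hg using hrest
      intro x y hxy
      have hcomp := pred_iff_of_preconnected hH.preconnected (P := fun z => (g z).1 = (g x).1)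
        (fun a b hab => by
          rw [hadj, hg, hg, hcc] at hab
          rw [hab.1]) x y
      rw [hadj, hg, hg, hcc]
      refine ⟨(hcomp.1 rfl).symm, fun h => hinj x y hxy ?_⟩
      rw [hg, hg, h]

lemma top_four_isIndContained {a b c d : V} (hab : H.Adj a b) (hac : H.Adj a c) (had : H.Adj a d)
    (hbc : H.Adj b c) (hbd : H.Adj b d) (hcd : H.Adj c d) :
    (⊤ : SimpleGraph (Fin 4)) ⊴ H :=
  top_isIndContained_of_adj ![a, b, c, d] (by simp [Fin.forall_fin_succ, *])

lemma top_three_isIndContained {a b c : V} (hab : H.Adj a b) (hac : H.Adj a c)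
    (hbc : H.Adj b c) : (⊤ : SimpleGraph (Fin 3)) ⊴ H :=
  top_isIndContained_of_adj ![a, b, c] (by simp [Fin.forall_fin_succ, *])

lemma exists_injOn_fin_two [Fintype V] (P : V → Prop)
    (h : ¬ ∃ x y z, P x ∧ P y ∧ P z ∧ x ≠ y ∧ x ≠ z ∧ y ≠ z) :
    ∃ r : V → Fin 2, ∀ x y, P x → P y → x ≠ y → r x ≠ r y := by
  classical
  have hcard : Fintype.card {x // P x} ≤ Fintype.card (Fin 2) := by
    by_contra hcon
    rw [Fintype.card_fin, not_le, Fintype.two_lt_card_iff] at hcon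
    obtain ⟨x, y, z, hxy, hxz, hyz⟩ := hcon
    exact h ⟨x, y, z, x.2, y.2, z.2, fun h => hxy (Subtype.ext h), fun h => hxz (Subtype.ext h),
      fun h => hyz (Subtype.ext h)⟩
  obtain ⟨e⟩ := Function.Embedding.nonempty_of_card_le hcard
  refine ⟨fun x => if hx : P x then e ⟨x, hx⟩ else 0, fun x y hx hy hxy => ?_⟩
  simp only [hx, hy, dite_true]
  exact fun h => hxy (congrArg Subtype.val (e.injective h))

lemma isIndContained_wGraph_or_k4Minus [Fintype V] (hH : H.Connected) {n : ℕ} (h : H ⊴ cliqueHub n)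
    (hC : ¬ SimpleGraph.cycleGraph 4 ⊴ H) (hK : ¬ (⊤ : SimpleGraph (Fin 4)) ⊴ H) :
    H ⊴ wGraph ∨ H ⊴ k4Minus := by
  classical
  have hcone : ∀ c col, IsColouredCone H c col → H ⊴ wGraph := by
    rintro c col ⟨hc, hcol⟩
    have hr : ∀ i, ∃ r : V → Fin 2, ∀ x y, (x ≠ c ∧ col x = i) → (y ≠ c ∧ col y = i) → x ≠ y →
        r x ≠ r y := by
      intro i
      refine exists_injOn_fin_two _ ?_
      rintro ⟨x, y, z, ⟨hxc, hx⟩, ⟨hyc, hy⟩, ⟨hzc, hz⟩, hxy, hxz, hyz⟩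
      exact hK (top_four_isIndContained (hc x hxc) (hc y hyc) (hc z hzc)
        ((hcol x y hxc hyc hxy).2 (hx.trans hy.symm)) ((hcol x z hxc hzc hxz).2 (hx.trans hz.symm))
        ((hcol y z hyc hzc hyz).2 (hy.trans hz.symm)))
    choose r hr using hr
    -- Each colour has at most two vertices, since three would form a `K₄` with `c`; each colour is
    -- sent to its own triangle of `W`.
    let f : V → Fin 7 := fun x => if x = c then 0 else
      ⟨1 + 2 * (col x).1 + (r (col x) x).1, by omega⟩
    have hf : ∀ x, x ≠ c → (f x).1 = 1 + 2 * (col x).1 + (r (col x) x).1 := by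
      intro x hx
      simp [f, hx]
    have hfc : f c = 0 := by simp [f]
    have hinj : Function.Injective f := by
      intro x y hxy
      by_contra hne
      have hxy := Fin.ext_iff.1 hxy
      by_cases hx : x = c
      · subst hx
        rw [hfc, hf y (Ne.symm hne)] at hxy
        simp only [Fin.val_zero] at hxy
        omega
      · by_cases hy : y = c
        · subst hy
          rw [hfc, hf x hne] at hxy
          simp only [Fin.val_zero] at hxy
          omega
        · rw [hf x hx, hf y hy] at hxy
          have h1 : col x = col y := by omega
          refine hr (col x) x y ⟨hx, rfl⟩ ⟨hy, h1.symm⟩ hne ?_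
          rw [← h1] at hxy
          omega
    refine isIndContained_of_injective f hinj fun x y => ?_
    rw [wGraph_adj, hinj.ne_iff]
    by_cases hxy : x = y
    · simp [hxy]
    by_cases hx : x = c
    · subst hx
      simp [hfc, hxy, hc y (Ne.symm hxy)]
    by_cases hy : y = c
    · subst hy
      simp [hfc, hxy, (hc x hxy).symm]
    rw [hcol x y hx hy hxy]
    have h1 := hf x hx
    have h2 := hf y hy
    simp only [Fin.ext_iff, Fin.val_zero, ne_eq, hxy, not_false_eq_true, true_and]
    omega
  rcases cliqueHub_cases hH h hC with hall | ⟨c, col, hcol⟩ | ⟨u, v, huv, hnadj, hrest⟩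
  · left
    obtain ⟨c⟩ := hH.nonempty
    exact hcone c (fun _ => 0) ⟨fun x hx => hall c x (Ne.symm hx),
      fun x y _ _ hxy => by simp [hall x y hxy]⟩
  · exact Or.inl (hcone c col hcol)
  · right
    obtain ⟨r, hr⟩ := exists_injOn_fin_two (fun x => x ≠ u ∧ x ≠ v) (by
      rintro ⟨x, y, z, ⟨hxu, hxv⟩, ⟨hyu, hyv⟩, ⟨hzu, hzv⟩, hxy, hxz, hyz⟩
      exact hK (top_four_isIndContained (hrest x hxu hxv).1 (hrest y hyu hyv).1
        (hrest z hzu hzv).1 ((hrest x hxu hxv).2.2 y hyu hyv hxy)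
        ((hrest x hxu hxv).2.2 z hzu hzv hxz) ((hrest y hyu hyv).2.2 z hzu hzv hyz)))
    let f : V → Fin 4 := fun x => if x = u then 2 else if x = v then 3 else (r x).castLE (by omega)
    have hfu : f u = 2 := by simp [f]
    have hfv : f v = 3 := by simp [f, huv.symm]
    have hf : ∀ x, x ≠ u → x ≠ v → (f x).1 = (r x).1 := by
      intro x hxu hxv
      simp [f, hxu, hxv]
    have hlt : ∀ x, (f x).1 < 2 ↔ x ≠ u ∧ x ≠ v := by
      intro x
      by_cases hxu : x = u
      · simp [hxu, hfu]
      by_cases hxv : x = v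
      · simp [hxv, hfv]
      have := hf x hxu hxv
      simp only [ne_eq, hxu, hxv, not_false_eq_true, and_self, iff_true]
      omega
    have hinj : Function.Injective f := by
      intro x y hxy
      by_contra hne
      have hl := hlt x
      rw [hxy, hlt y] at hl
      by_cases hx : x ≠ u ∧ x ≠ v
      · have hy := hl.2 hx
        have h1 := hf x hx.1 hx.2
        have h2 := hf y hy.1 hy.2
        refine hr x y hx hy hne (Fin.ext ?_)
        rw [← h1, ← h2, hxy]
      · have hy : ¬ (y ≠ u ∧ y ≠ v) := fun h => hx (hl.1 h)
        have h2 : x = u ∨ x = v := by tauto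
        have h3 : y = u ∨ y = v := by tauto
        rcases h2 with rfl | rfl <;> rcases h3 with rfl | rfl <;> simp_all
    refine isIndContained_of_injective f hinj fun x y => ?_
    rw [k4Minus_adj, hinj.ne_iff, hlt, hlt]
    by_cases hxy : x = y
    · simp [hxy]
    by_cases hx : x ≠ u ∧ x ≠ v
    · obtain ⟨h1, h2, h3⟩ := hrest x hx.1 hx.2
      have : H.Adj x y := by
        by_cases hyu : y = u
        · exact hyu ▸ h1.symm
        by_cases hyv : y = v
        · exact hyv ▸ h2.symm
        exact h3 y hyu hyv hxy
      simp [hxy, hx, this]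
    by_cases hy : y ≠ u ∧ y ≠ v
    · obtain ⟨h1, h2, h3⟩ := hrest y hy.1 hy.2
      have : H.Adj y x := by
        by_cases hxu : x = u
        · exact hxu ▸ h1.symm
        by_cases hxv : x = v
        · exact hxv ▸ h2.symm
        exact h3 x hxu hxv (Ne.symm hxy)
      simp [hxy, hy, this.symm]
    have h2 : x = u ∨ x = v := by tauto
    have h3 : y = u ∨ y = v := by tauto
    have hnadj' : ¬ H.Adj v u := fun h => hnadj h.symm
    rcases h2 with rfl | rfl <;> rcases h3 with rfl | rfl <;> simp_all

/-- Without triangles, each colour of a cone is used at most once, so `col` also bounds the number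
of leaves by three. -/
lemma exists_star (hH : H.Connected) {n : ℕ} (h : H ⊴ cliqueHub n)
    (hC : ¬ SimpleGraph.cycleGraph 4 ⊴ H) (hK : ¬ (⊤ : SimpleGraph (Fin 3)) ⊴ H) :
    ∃ (c : V) (col : V → Fin 3), (∀ x, x ≠ c → H.Adj c x) ∧
      ∀ x y, x ≠ c → y ≠ c → x ≠ y → ¬ H.Adj x y ∧ col x ≠ col y := by
  classical
  rcases cliqueHub_cases hH h hC with hall | ⟨c, col, hc, hcol⟩ | ⟨u, v, huv, hnadj, hrest⟩
  · obtain ⟨c⟩ := hH.nonempty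
    refine ⟨c, fun _ => 0, fun x hx => hall c x (Ne.symm hx), fun x y hx hy hxy => ?_⟩
    exact absurd (top_three_isIndContained (hall c x (Ne.symm hx)) (hall c y (Ne.symm hy))
      (hall x y hxy)) hK
  · refine ⟨c, col, hc, fun x y hx hy hxy => ?_⟩
    have hna : ¬ H.Adj x y := fun h => hK (top_three_isIndContained (hc x hx) (hc y hy) h)
    exact ⟨hna, fun h => hna ((hcol x y hx hy hxy).2 h)⟩
  · obtain ⟨c, hcu, hcv⟩ : ∃ c, c ≠ u ∧ c ≠ v := by
      by_contra! hcon
      have := pred_iff_of_preconnected hH.preconnected (P := fun x => x = u) (fun x y hxy => by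
        by_cases hx : x = u <;> by_cases hy : y = u
        · simp [hx, hy]
        · exact absurd (hcon y hy ▸ hx ▸ hxy) hnadj
        · exact absurd (hcon x hx ▸ hy ▸ hxy).symm hnadj
        · simp [hx, hy]) u v
      exact huv (this.1 rfl).symm
    have honly : ∀ x, x ≠ c → x = u ∨ x = v := by
      intro x hx
      by_contra! hcon
      exact hK (top_three_isIndContained (hrest c hcu hcv).1 (hrest x hcon.1 hcon.2).1
        ((hrest c hcu hcv).2.2 x hcon.1 hcon.2 (Ne.symm hx)))
    refine ⟨c, fun x => if x = u then 0 else 1, fun x hx => ?_, fun x y hx hy hxy => ?_⟩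
    · rcases honly x hx with rfl | rfl
      exacts [(hrest c hcu hcv).1.symm, (hrest c hcu hcv).2.1.symm]
    · rcases honly x hx with rfl | rfl <;> rcases honly y hy with rfl | rfl
      · exact absurd rfl hxy
      · exact ⟨hnadj, by simp [huv.symm]⟩
      · exact ⟨fun h => hnadj h.symm, by simp [huv.symm]⟩
      · exact absurd rfl hxy

lemma isIndContained_claw (hH : H.Connected) {n : ℕ} (h : H ⊴ cliqueHub n)
    (hC : ¬ SimpleGraph.cycleGraph 4 ⊴ H) (hK : ¬ (⊤ : SimpleGraph (Fin 3)) ⊴ H) :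
    H ⊴ claw := by
  classical
  obtain ⟨c, col, hc, hcol⟩ := exists_star hH h hC hK
  refine isIndContained_of_injective (fun x => if x = c then .inl 0 else .inr (col x)) ?_ ?_
  · intro x y hxy
    by_contra hne
    by_cases hx : x = c <;> by_cases hy : y = c
    · exact hne (hx.trans hy.symm)
    · simp [hx, hy] at hxy
    · simp [hx, hy] at hxy
    · simp only [hx, hy, if_false, Sum.inr.injEq] at hxy
      exact (hcol x y hx hy hne).2 hxy
  · intro x y
    by_cases hx : x = c <;> by_cases hy : y = c
    · simp [hx, hy]
    · simp [hx, hy, hc y hy]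
    · simp [hx, hy, (hc x hx).symm]
    · by_cases hxy : x = y
      · simp [hxy]
      · simp [hx, hy, (hcol x y hx hy hxy).1]

lemma isIndContained_pathGraph_three [Fintype V] (hH : H.Connected) {n : ℕ} (h : H ⊴ cliqueHub n)
    (hC : ¬ SimpleGraph.cycleGraph 4 ⊴ H) (hK : ¬ (⊤ : SimpleGraph (Fin 3)) ⊴ H)
    (hclaw : ¬ claw ⊴ H) : H ⊴ SimpleGraph.pathGraph 3 := by
  classical
  obtain ⟨c, col, hc, hcol⟩ := exists_star hH h hC hK
  obtain ⟨r, hr⟩ := exists_injOn_fin_two (fun x => x ≠ c) (by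
    rintro ⟨x, y, z, hx, hy, hz, hxy, hxz, hyz⟩
    have h1 := (hcol x y hx hy hxy).1
    have h2 := (hcol x z hx hz hxz).1
    have h3 := (hcol y z hy hz hyz).1
    have h1' : ¬ H.Adj y x := fun h => h1 h.symm
    have h2' : ¬ H.Adj z x := fun h => h2 h.symm
    have h3' : ¬ H.Adj z y := fun h => h3 h.symm
    refine hclaw (isIndContained_of_injective (Sum.elim (fun _ => c) ![x, y, z]) ?_ ?_)
    · rintro (s | s) (t | t) h
      · rw [Subsingleton.elim s t]
      · fin_cases t <;> simp_all
      · fin_cases s <;> simp_all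
      · fin_cases s <;> fin_cases t <;> simp_all [eq_comm]
    · rintro (s | s) (t | t)
      · simp
      · fin_cases t <;> simp [hc, hx, hy, hz]
      · fin_cases s <;> simp [(hc x hx).symm, (hc y hy).symm, (hc z hz).symm]
      · fin_cases s <;> fin_cases t <;>
          simp [h1, h2, h3, h1', h2', h3'])
  have hval : ∀ x, (if x = c then (1 : Fin 3) else ⟨2 * (r x).1, by omega⟩).1 =
      if x = c then 1 else 2 * (r x).1 := by
    intro x
    split_ifs <;> rfl
  refine isIndContained_of_injective
    (fun x => if x = c then (1 : Fin 3) else ⟨2 * (r x).1, by omega⟩) ?_ ?_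
  · intro x y hxy
    by_contra hne
    have hxy := Fin.ext_iff.1 hxy
    dsimp only at hxy
    rw [hval, hval] at hxy
    by_cases hx : x = c <;> by_cases hy : y = c
    · exact hne (hx.trans hy.symm)
    · simp only [hx, hy, if_true, if_false] at hxy
      omega
    · simp only [hx, hy, if_true, if_false] at hxy
      omega
    · simp only [hx, hy, if_false] at hxy
      exact hr x y hx hy hne (Fin.ext (by omega))
  · intro x y
    rw [SimpleGraph.pathGraph_adj, hval, hval]
    by_cases hx : x = c <;> by_cases hy : y = c
    · simp [hx, hy]
    · simp only [hx, hy, if_true, if_false, hc y hy, iff_true]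
      omega
    · simp only [hx, hy, if_true, if_false, (hc x hx).symm, iff_true]
      omega
    · simp only [hx, hy, if_false]
      have : ¬ H.Adj x y := by
        by_cases hxy : x = y
        · simp [hxy]
        · exact (hcol x y hx hy hxy).1
      simp only [this, iff_false]
      omega

end CliqueHub

/-! ### The case analysis -/

section Main

/-- The two legs are swapped; the remainders only supply bounds. -/
lemma net_two_one_zero_bull : net 2 1 0 ⊴ bull 1 2 := by
  refine isIndContained_of_injective
    (fun p => if p.1 = 0 then ⟨1, ⟨p.2 % 3, Nat.mod_lt _ (by decide)⟩⟩
      else if p.1 = 1 then ⟨0, ⟨p.2 % 2, Nat.mod_lt _ (by decide)⟩⟩ else ⟨2, 0⟩) (by decide) ?_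
  simp only [bull, net_adj_iff]
  decide

lemma familyLE_pair {A B : FinGraph} {V W : Type} [Fintype V] [Fintype W] {X : SimpleGraph V}
    {Y : SimpleGraph W} (hX : A.graph ⊴ X ∨ B.graph ⊴ X) (hY : A.graph ⊴ Y ∨ B.graph ⊴ Y) :
    FamilyLE {A, B} {.of X, .of Y} := by
  rintro H (rfl | rfl)
  · rcases hX with h | h
    exacts [⟨A, by simp, h⟩, ⟨B, by simp, h⟩]
  · rcases hY with h | h
    exacts [⟨A, by simp, h⟩, ⟨B, by simp, h⟩]

/-- Every obstruction on sufficiently many vertices contains `A` or `B`. -/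
def CoversObstructions (A B : FinGraph) : Prop :=
  ∃ n₀, ∀ G, IsObstruction n₀ G → A.graph ⊴ G.graph ∨ B.graph ⊴ G.graph

lemma CoversObstructions.symm {A B : FinGraph} (h : CoversObstructions A B) :
    CoversObstructions B A := by
  obtain ⟨n₀, h⟩ := h
  exact ⟨n₀, fun G hG => (h G hG).symm⟩

lemma cliqueHub_isObstruction (n : ℕ) : IsObstruction n (.of (cliqueHub n)) :=
  hubFamily_isObstruction (by decide) (by decide) n

lemma cliqueAdjHub_isObstruction (n : ℕ) : IsObstruction n (.of (cliqueAdjHub n)) :=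
  hubFamily_isObstruction (by decide) (by decide) n

lemma starHub_isObstruction (n : ℕ) : IsObstruction n (.of (starHub n)) :=
  hubFamily_isObstruction (by decide) (by decide) n

lemma leafHub_isObstruction (n : ℕ) : IsObstruction n (.of (leafHub n)) :=
  hubFamily_isObstruction (by decide) (by decide) n

lemma mixedHub_isObstruction (n : ℕ) : IsObstruction n (.of (mixedHub n)) :=
  hubFamily_isObstruction (by decide) (by decide) n

/-- The theorem when one of the two graphs is a path. -/
lemma exists_familyLE_of_path {A B : FinGraph} (hB : B.graph.Connected)
    (hAB : CoversObstructions A B) {j : ℕ}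
    (hA : Nonempty (A.graph ≃g SimpleGraph.pathGraph j)) : ∃ i, FamilyLE {A, B} (pair i) := by
  obtain ⟨e⟩ := hA
  obtain ⟨n, hAB⟩ := hAB
  have hle : ∀ k, j ≤ k → A.graph ⊴ SimpleGraph.pathGraph k := fun k hk =>
    e.isIndContained.trans (pathGraph_mono hk)
  have hge : ∀ k, k ≤ j → SimpleGraph.pathGraph k ⊴ A.graph := fun k hk =>
    (pathGraph_mono hk).trans e.symm.isIndContained
  have hP3 : SimpleGraph.pathGraph 3 ⊴ net 4 0 0 :=
    (pathGraph_mono (by norm_num)).trans pathGraph_six_net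
  by_cases hj3 : j ≤ 3
  · exact ⟨0, familyLE_pair (Or.inl ((hle 3 hj3).trans pathGraph_three_claw))
      (Or.inl ((hle 3 hj3).trans hP3))⟩
  have hB' : ∀ {k : ℕ} {G : FinGraph}, IsObstruction n G → k ≤ j →
      ¬ SimpleGraph.pathGraph k ⊴ G.graph → B.graph ⊴ G.graph := fun {k G} hG hk hn =>
    (hAB G hG).resolve_left fun h => hn ((hge k hk).trans h)
  have h4 : 4 ≤ j := by omega
  have hX : B.graph ⊴ cliqueHub n :=
    hB' (cliqueHub_isObstruction n) h4 (pathGraph_four_not_cliqueHub n)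
  have hC : ¬ SimpleGraph.cycleGraph 4 ⊴ B.graph := fun h =>
    cycleGraph_four_not_cliqueAdjHub n
      (h.trans (hB' (cliqueAdjHub_isObstruction n) h4 (pathGraph_four_not_cliqueAdjHub n)))
  have hK : ¬ (⊤ : SimpleGraph (Fin 4)) ⊴ B.graph := fun h =>
    top_four_not_starHub n
      (h.trans (hB' (starHub_isObstruction n) h4 (pathGraph_four_not_starHub n)))
  by_cases hj5 : j ≤ 5
  · rcases isIndContained_wGraph_or_k4Minus hB hX hC hK with hW | hK4
    · by_cases hj4 : j ≤ 4
      · exact ⟨3, familyLE_pair (Or.inl (hle 4 hj4)) (Or.inr hW)⟩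
      -- For `j = 5` the graph `W` itself is excluded, so `B` is a proper induced subgraph of it.
      · have hM := hB' (mixedHub_isObstruction n) (show 5 ≤ j by omega)
          (pathGraph_five_not_mixedHub n)
        exact ⟨5, familyLE_pair (Or.inl (hle 5 hj5)) (Or.inr (isIndContained_wStar hB hW
          fun h => wGraph_not_mixedHub n (h.trans hM)))⟩
    · exact ⟨6, familyLE_pair (Or.inl (hle 5 hj5)) (Or.inr hK4)⟩
  · have hK3 : ¬ (⊤ : SimpleGraph (Fin 3)) ⊴ B.graph := fun h =>
      top_three_not_leafHub n
        (h.trans (hB' (leafHub_isObstruction n) (show 6 ≤ j by omega) (pathGraph_six_not_leafHub n)))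
    by_cases hj6 : j ≤ 6
    · exact ⟨0, familyLE_pair (Or.inr (isIndContained_claw hB hX hC hK3))
        (Or.inl ((hle 6 hj6).trans pathGraph_six_net))⟩
    · have hQ := hB' (cliquePrism_isObstruction true n) (show 7 ≤ j by omega)
        (pathGraph_seven_not_cliquePrism n)
      have hP := isIndContained_pathGraph_three hB hX hC hK3
        fun h => claw_not_cliquePrism true n (h.trans hQ)
      exact ⟨0, familyLE_pair (Or.inr (hP.trans pathGraph_three_claw)) (Or.inr (hP.trans hP3))⟩

/-- The theorem when `A` is contained in a subdivided claw. -/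
lemma exists_familyLE_of_spider {A B : FinGraph} (hA : A.graph.Connected)
    (hB : B.graph.Connected) (hAB : CoversObstructions A B) (hs : A.graph ⊴ spider) :
    ∃ i, FamilyLE {A, B} (pair i) := by
  obtain ⟨φ⟩ := hs
  rcases spider_cases hA φ with ⟨j, hj⟩ | ⟨hφ, hφ'⟩
  · exact exists_familyLE_of_path hB hAB hj
  have hclaw := claw_isIndContained_of_spider φ hφ hφ'
  have hAB' := hAB
  obtain ⟨n, hAB⟩ := hAB
  have hB' : ∀ {G : FinGraph}, IsObstruction n G → ¬ claw ⊴ G.graph → B.graph ⊴ G.graph :=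
    fun {G} hG hn => (hAB G hG).resolve_left fun h => hn (hclaw.trans h)
  have hN : B.graph ⊴ infiniteNet := by
    -- The paths must be long compared with `B` as well as with the threshold `n`.
    obtain ⟨h1, h2, h3⟩ := pathPrism_isObstruction (max n (Fintype.card B.V))
    refine isIndContained_infiniteNet hB.preconnected (le_max_right n _)
      (hB' ⟨h1, h2, (le_max_left _ _).trans h3⟩ (claw_not_pathPrism _))
  obtain ⟨ψ⟩ := hN
  rcases infiniteNet_cases hB ψ with ⟨j, hj⟩ | hψ
  · obtain ⟨i, hi⟩ := exists_familyLE_of_path hA hAB'.symm hj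
    exact ⟨i, Set.pair_comm A B ▸ hi⟩
  obtain ⟨a, b, c, hba, hcb, hlow, hup⟩ := exists_sorted_net hB ψ hψ
  have hQ := hB' (cliquePrism_isObstruction true n) (claw_not_cliquePrism true n)
  have hQ' := hB' (cliquePrism_isObstruction false n) (claw_not_cliquePrism false n)
  by_cases hAc : A.graph ⊴ claw
  -- With `a ≥ b ≥ c`, the four exclusions leave only nets inside `Z₄`, `B_{1,2}` or `N_{1,1,1}`.
  · have h500 : ¬ 5 ≤ a := fun h => pathGraph_seven_not_cliquePrism n
      (pathGraph_seven_net.trans ((hlow 5 0 0 h (by omega) (by omega)).trans hQ))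
    have h310 : ¬ (3 ≤ a ∧ 1 ≤ b) := fun h => net_three_one_zero_not_cliquePrism n
      ((hlow 3 1 0 h.1 h.2 (by omega)).trans hQ)
    have h211 : ¬ (2 ≤ a ∧ 1 ≤ b ∧ 1 ≤ c) := fun h => net_two_one_one_not_cliquePrism n
      ((hlow 2 1 1 h.1 h.2.1 h.2.2).trans hQ)
    have h220 : ¬ (2 ≤ a ∧ 2 ≤ b) := fun h => net_two_two_zero_not_cliquePrism n
      ((hlow 2 2 0 h.1 h.2 (by omega)).trans hQ')
    by_cases hb : b = 0
    · exact ⟨0, familyLE_pair (Or.inl hAc) (Or.inr (hup 4 0 0 (by omega) (by omega) (by omega)))⟩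
    by_cases hc : c = 0
    · exact ⟨1, familyLE_pair (Or.inl hAc) (Or.inr
        ((hup 2 1 0 (by omega) (by omega) (by omega)).trans net_two_one_zero_bull))⟩
    · exact ⟨2, familyLE_pair (Or.inl hAc) (Or.inr (hup 1 1 1 (by omega) (by omega) (by omega)))⟩
  · have hP4 : SimpleGraph.pathGraph 4 ⊴ A.graph := by
      by_contra h
      exact hAc (isIndContained_claw_of_spider φ hA hφ hφ' h)
    have hBX : B.graph ⊴ cliqueHub n := (hAB _ (cliqueHub_isObstruction n)).resolve_left
      fun h => pathGraph_four_not_cliqueHub n (hP4.trans h)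
    have h200 : ¬ 2 ≤ a := fun h => pathGraph_four_not_cliqueHub n
      (pathGraph_four_net_two_zero_zero.trans ((hlow 2 0 0 h (by omega) (by omega)).trans hBX))
    have h110 : ¬ (1 ≤ a ∧ 1 ≤ b) := fun h => pathGraph_four_not_cliqueHub n
      (pathGraph_four_net_one_one_zero.trans ((hlow 1 1 0 h.1 h.2 (by omega)).trans hBX))
    have hK3 := top_three_net.trans (hlow 0 0 0 (by omega) (by omega) (by omega))
    have hAL : A.graph ⊴ leafHub n := (hAB _ (leafHub_isObstruction n)).resolve_right
      fun h => top_three_not_leafHub n (hK3.trans h)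
    exact ⟨4, familyLE_pair (Or.inl (isIndContained_clawStar_of_spider φ hA hφ hφ'
      fun h => longClaw_not_leafHub n (h.trans hAL)))
      (Or.inr (hup 1 0 0 (by omega) (by omega) (by omega)))⟩

end Main

end ForbiddenPair

open ForbiddenPair in
theorem theorem1 (H₁ H₂ : FinGraph)
    (hH₁ : H₁.graph.Connected) (hH₂ : H₂.graph.Connected)
    (h : ∃ n₀ : ℕ, 0 < n₀ ∧ ∀ G : FinGraph,
      TwoConnected G → IsFree {H₁, H₂} G → n₀ ≤ G.order → HasDominatingCycle G) :
    ∃ i : Fin 7, FamilyLE {H₁, H₂} (pair i) := by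
  obtain ⟨n₀, -, h⟩ := h
  have hcov : CoversObstructions H₁ H₂ := by
    refine ⟨n₀, fun G hG => ?_⟩
    by_contra! hcon
    refine hG.2.1 (h G hG.1 ?_ hG.2.2)
    rintro H (rfl | rfl)
    exacts [hcon.1, hcon.2]
  -- The size is chosen before it is known which graph embeds, so it exceeds both orders.
  obtain ⟨h1, h2, h3⟩ := thetaFamily_isObstruction (n₀ + H₁.order + H₂.order)
  have hor : H₁.graph ⊴ thetaFamily (n₀ + H₁.order + H₂.order) ∨
      H₂.graph ⊴ thetaFamily (n₀ + H₁.order + H₂.order) := by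
    by_contra! hcon
    refine h2 (h _ h1 ?_ (by omega))
    rintro H (rfl | rfl)
    exacts [hcon.1, hcon.2]
  rcases hor with hor | hor
  · exact exists_familyLE_of_spider hH₁ hH₂ hcov
      (isIndContained_spider hH₁.preconnected (by unfold FinGraph.order; omega) hor)
  · obtain ⟨i, hi⟩ := exists_familyLE_of_spider hH₂ hH₁ hcov.symm
      (isIndContained_spider hH₂.preconnected (by unfold FinGraph.order; omega) hor)
    exact ⟨i, Set.pair_comm H₁ H₂ ▸ hi⟩
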